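/- **Setting.** Let $k$ be a subfield of $\mathbb C$, let $m\ge 0$, let $k[Z^{\pm1}]=k[z_1^{\pm1},\dots,z_m^{\pm1}]$ with fraction field $K$, and let $k_+[Z^{\pm1}]$ be the set of Laurent polynomials all of whose coefficients are nonnegative reals. Let $\Gamma$ be a finite oriented graph with vertices $v_0,\dots,v_{n-1}$, whose arrow $v_j\to v_i$ carries the weight $a_{i,j}\in k_+[Z^{\pm1}]$ (weight $0$ meaning no arrow), and let $A=(a_{i,j})$. Assume that $\Gamma$ is strongly connected (any two vertices, equal or not, are joined by an oriented path with at least one arrow) and positively multiplicative at $v_0$: there is a $K$-subalgebra of $M_n(K)$ containing $k[Z^{\pm1}][A]$ with a $K$-basis $b_0,\dots,b_{n-1}$ such that $b_0=1$, $Ab_j=\sum_i a_{i,j}b_i$ for all $j$, and $b_ib_j=\sum_l c_{i,j}^l b_l$ with all $c_{i,j}^l\in k_+[Z^{\pm1}]$. Assume that the $k[Z^{\pm1}]$-algebra $\mathcal A=\bigoplus_i k[Z^{\pm1}]b_i$ is commutative and a domain. The *expansion* $\Gamma_e$ is the infinite graded graph with root $(v_0,1,0)$ whose vertices are the triples $(v_i,z^\beta,\ell)$,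 $\beta\in\mathbb Z^m$, $\ell\in\mathbb N$, obtained inductively from the root as follows: if $(v_j,z^\beta,\ell)$ is a vertex and the monomial $z^\delta$ has coefficient $c\neq0$ in $a_{i,j}$, then $(v_i,z^{\beta+\delta},\ell+1)$ is a vertex of $\Gamma_e$ and there is an arrow of weight $c$ from the former to the latter. Write $a_{v',v}$ for the weight of the arrow $v\to v'$ of $\Gamma_e$. Let $q$ be a new indeterminate, let $\mathfrak B_e=\{q^\ell z^\beta b_i : (v_i,z^\beta,\ell)\in\Gamma_e\}\subset\mathcal A\otimes_k k[q]$, write $b_v=q^\ell z^\beta b_i$ for $v=(v_i,z^\beta,\ell)$, and let $\mathcal A_e$ be the $k$-span of $\mathfrak B_e$. A *nonnegative harmonic function* on $\Gamma_e$ is a map $f:\Gamma_e\to\mathbb R_{\ge0}$ with $f(v_0,1,0)=1$ and $f(v)=\sum_{v\to v'}a_{v',v}f(v')$ for every vertex $v$. Let $\mathcal H_\partial^+(\Gamma_e)$ be the set of extreme points of the convex set of nonnegative harmonic functions that are positive at every vertex. **Theorem.** 1. $\Gamma_e$ is positively multiplicative with basis $\mathfrak B_e$: $\mathcal A_e$ is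 a $k$-subalgebra of $\mathcal A\otimes_k k[q]$ with $k$-basis $\mathfrak B_e$, the basis element of the root is $1$, products of elements of $\mathfrak B_e$ expand on $\mathfrak B_e$ with nonnegative real coefficients, and $\gamma b_v=\sum_{v\to v'}a_{v',v}b_{v'}$ for every vertex $v$ of $\Gamma_e$, where $\gamma=\sum_{(v_0,1,0)\to v'}a_{v',(v_0,1,0)}b_{v'}$. 2. For $t\in\mathbb R_{>0}^m$ let $A_t=(a_{i,j}(t))$ be the specialization of $A$ at $z=t$. It has a unique left Perron–Frobenius vector $\pi=(\pi_0,\dots,\pi_{n-1})$ normalized by $\pi_0=1$ (a left eigenvector with positive entries, for an eigenvalue whose modulus is maximal among all complex eigenvalues). Put $s=\bigl(\sum_i a_{i,0}(t)\pi_i\bigr)^{-1}$ and $$f_t(v_i,z^\beta,q^\ell)=t^\beta s^\ell\pi_i .$$ Then $f_t\in\mathcal H_\partial^+(\Gamma_e)$ for every $t\in\mathbb R_{>0}^m$, and every element of $\mathcal H_\partial^+(\Gamma_e)$ is of the form $f_t$ for some $t\in\mathbb R_{>0}^m$. In particular there is a subset $T\subseteq\mathbb R_{>0}^m$ such that $t\mapsto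 f_t$ is a bijection from $T$ onto $\mathcal H_\partial^+(\Gamma_e)$. -/

import Mathlib

noncomputable section

/-! ### Laurent polynomials with nonnegative coefficients -/

/-- The Laurent polynomial ring `k[z₁^{±1}, …, z_m^{±1}]`; the exponent `β : Fin m → ℤ` stands for
the monomial `z^β`. -/
abbrev LaurentRing (k : Subfield ℂ) (m : ℕ) : Type := AddMonoidAlgebra k (Fin m → ℤ)

/-- The fraction field `K = k(z₁, …, z_m)`. -/
abbrev LaurentField (k : Subfield ℂ) (m : ℕ) : Type := FractionRing (LaurentRing k m)

/-- `x ∈ k ⊆ ℂ` is a nonnegative real number. -/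
def IsNonnegReal {k : Subfield ℂ} (x : k) : Prop := 0 ≤ (x : ℂ).re ∧ (x : ℂ).im = 0

/-- Membership in `k₊[Z^{±1}]`: all coefficients are nonnegative reals. -/
def IsNonnegLaurent {k : Subfield ℂ} {m : ℕ} (p : LaurentRing k m) : Prop :=
  ∀ β, IsNonnegReal (p.coeff β)

/-- The real number `t^β = t₁^{β₁} ⋯ t_m^{β_m}`. -/
def monomialValue {m : ℕ} (t : Fin m → ℝ) (β : Fin m → ℤ) : ℝ := ∏ r, t r ^ β r

/-- The specialization at `z = t` of a Laurent polynomial with real coefficients. -/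
def specialize {k : Subfield ℂ} {m : ℕ} (t : Fin m → ℝ) (p : LaurentRing k m) : ℝ :=
  p.coeff.sum fun β c => (c : ℂ).re * monomialValue t β

/-! ### Finite graphs and positively multiplicative graphs -/

/-- A finite oriented graph with vertex set `V` and arrows weighted in `k₊[Z^{±1}]`. The entry
`adj i j` is the total weight `a_{i,j}` of the arrow `v_j → v_i`; it is `0` if there is none. -/
structure FinGraph (k : Subfield ℂ) (m : ℕ) (V : Type*) where
  adj : Matrix V V (LaurentRing k m)
  nonneg : ∀ i j, IsNonnegLaurent (adj i j)

/-- Any two vertices (equal or not) are joined by an oriented path with at least one arrow. -/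
def FinGraph.StronglyConnected {k : Subfield ℂ} {m : ℕ} {V : Type*} (Γ : FinGraph k m V) : Prop :=
  ∀ i j, Relation.TransGen (fun a b => Γ.adj b a ≠ 0) i j

/-- The adjacency matrix, with entries in the field `K`. -/
def FinGraph.adjK {k : Subfield ℂ} {m : ℕ} {V : Type*} (Γ : FinGraph k m V) :
    Matrix V V (LaurentField k m) :=
  Γ.adj.map (algebraMap (LaurentRing k m) (LaurentField k m))

/-- The real matrix `A_t` obtained from the adjacency matrix by setting `z = t`. -/
def FinGraph.adjAt {k : Subfield ℂ} {m : ℕ} {V : Type*} (Γ : FinGraph k m V) (t : Fin m → ℝ) :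
    Matrix V V ℝ :=
  Γ.adj.map (specialize t)

/-- The data making `Γ` a multiplicative graph at the root `v₀`: a `K`-subalgebra of the matrix
algebra `M_n(K)` that contains the adjacency algebra `k[Z^{±1}][A]`, with a `K`-basis `(b_i)`
indexed by the vertices such that `b_{v₀} = 1` and `A b_j = ∑ i, a_{i,j} b_i`. -/
structure MultiplicativeGraph {k : Subfield ℂ} {m : ℕ} {V : Type*} [Fintype V] [DecidableEq V]
    (Γ : FinGraph k m V) (v₀ : V) where
  alg : Subalgebra (LaurentField k m) (Matrix V V (LaurentField k m))
  adjoin_le : Algebra.adjoin (LaurentRing k m) {Γ.adjK} ≤ alg.restrictScalars (LaurentRing k m)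
  basis : Module.Basis V (LaurentField k m) alg
  basis_root : basis v₀ = 1
  adj_mul : ∀ j, Γ.adjK * (basis j : Matrix V V (LaurentField k m)) =
    ∑ i, Γ.adjK i j • (basis i : Matrix V V (LaurentField k m))

/-- The data making `Γ` a positively multiplicative graph at `v₀`: moreover the structure constants
`c_{i,j}^l` of the basis lie in `k₊[Z^{±1}]`. -/
structure PMGraph {k : Subfield ℂ} {m : ℕ} {V : Type*} [Fintype V] [DecidableEq V]
    (Γ : FinGraph k m V) (v₀ : V) extends MultiplicativeGraph Γ v₀ where
  structure_nonneg : ∀ i j l, ∃ c : LaurentRing k m, IsNonnegLaurent c ∧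
    basis.repr (basis i * basis j) l = algebraMap (LaurentRing k m) (LaurentField k m) c

namespace PMGraph

variable {k : Subfield ℂ} {m : ℕ} {V : Type*} [Fintype V] [DecidableEq V]
  {Γ : FinGraph k m V} {v₀ : V}

/-- The basis element `b_i` as a matrix. -/
def b (D : PMGraph Γ v₀) (i : V) : Matrix V V (LaurentField k m) := D.basis i

theorem b_root (D : PMGraph Γ v₀) : D.b v₀ = 1 := by
  simp [b, D.basis_root]

theorem b_mul_mem (D : PMGraph Γ v₀) (i j : V) :
    D.b i * D.b j ∈ Submodule.span (LaurentRing k m) (Set.range D.b) := by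
  have h := D.basis.sum_repr (D.basis i * D.basis j)
  have h3 : D.b i * D.b j = ∑ l, (D.basis.repr (D.basis i * D.basis j) l) • D.b l := by
    have h4 : ((∑ l, (D.basis.repr (D.basis i * D.basis j)) l • D.basis l : D.alg) :
        Matrix V V (LaurentField k m)) =
        ∑ l, (D.basis.repr (D.basis i * D.basis j)) l • D.b l := by
      rw [AddSubmonoidClass.coe_finsetSum]
      rfl
    rw [← h4, h]
    rfl
  rw [h3]
  refine Submodule.sum_mem _ fun l _ => ?_
  obtain ⟨c, -, hc⟩ := D.structure_nonneg i j l
  rw [hc, algebraMap_smul]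
  exact Submodule.smul_mem _ _ (Submodule.subset_span ⟨l, rfl⟩)

/-- The `k[Z^{±1}]`-algebra `𝒜 = ⨁ k[Z^{±1}] b_i` associated to a positively multiplicative
graph. -/
def algebra (D : PMGraph Γ v₀) : Subalgebra (LaurentRing k m) (Matrix V V (LaurentField k m)) :=
  Submodule.toSubalgebra (Submodule.span (LaurentRing k m) (Set.range D.b))
    (D.b_root ▸ Submodule.subset_span ⟨v₀, rfl⟩)
    (by
      intro x y hx hy
      induction hx, hy using Submodule.span_induction₂ with
      | mem_mem x y hx hy =>
        obtain ⟨i, rfl⟩ := hx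
        obtain ⟨j, rfl⟩ := hy
        exact D.b_mul_mem i j
      | zero_left y hy => simp
      | zero_right x hx => simp
      | add_left x y z _ _ _ h1 h2 => rw [add_mul]; exact add_mem h1 h2
      | add_right x y z _ _ _ h1 h2 => rw [mul_add]; exact add_mem h1 h2
      | smul_left r x y _ _ h => rw [smul_mul_assoc]; exact Submodule.smul_mem _ _ h
      | smul_right r x y _ _ h => rw [mul_smul_comm]; exact Submodule.smul_mem _ _ h)

/-- The basis element `b_i` as an element of `𝒜`. -/
def bAlg (D : PMGraph Γ v₀) (i : V) : D.algebra :=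
  ⟨D.b i, Submodule.subset_span ⟨i, rfl⟩⟩

/-- The element `q^ℓ z^β b_i` of `𝒜 ⊗_k k[q] = 𝒜[q]`, where `q` is the polynomial variable. -/
def expansionElement (D : PMGraph Γ v₀) (x : V × (Fin m → ℤ) × ℕ) : Polynomial D.algebra :=
  Polynomial.monomial x.2.2 ((AddMonoidAlgebra.single x.2.1 (1 : k) : LaurentRing k m) • D.bAlg x.1)

end PMGraph

/-! ### Infinite graded graphs and harmonic functions -/

/-- An infinite rooted graded oriented graph on the vertex set `W`, with arrows `v → v'` weighted by
the nonnegative reals `weight v v' ∈ k` (there is an arrow `v → v'` exactly when the weight is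
nonzero), each vertex having finitely many outgoing arrows. -/
structure GradedGraph (k : Subfield ℂ) (W : Type*) where
  root : W
  rank : W → ℕ
  weight : W → W → k
  rank_root : rank root = 0
  nonneg : ∀ v v', IsNonnegReal (weight v v')
  rank_succ : ∀ v v', weight v v' ≠ 0 → rank v' = rank v + 1
  finite : ∀ v, (Function.support (weight v)).Finite

namespace GradedGraph

variable {k : Subfield ℂ} {W : Type*}

/-- The graph is positively multiplicative for the `k`-algebra `𝔸` with distinguished basis `B`:
`b_root = 1`, the structure constants of `B` are nonnegative reals, and
`γ b_v = ∑_{v → v'} a_{v',v} b_{v'}` for every `v`, where `γ = ∑_{root → v'} a_{v',root} b_{v'}`. -/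
structure IsPositivelyMultiplicative (G : GradedGraph k W) {𝔸 : Type*} [Semiring 𝔸] [Algebra k 𝔸]
    (B : Module.Basis W k 𝔸) : Prop where
  root_eq_one : B G.root = 1
  structure_nonneg : ∀ u v w, IsNonnegReal (B.repr (B u * B v) w)
  gamma_mul : ∀ v, (∑ᶠ v', G.weight G.root v' • B v') * B v = ∑ᶠ v', G.weight v v' • B v'

/-- The set `ℋ(G)` of nonnegative harmonic functions, normalized by `f(root) = 1`. -/
def harmonic (G : GradedGraph k W) : Set (W → ℝ) :=
  {f | f G.root = 1 ∧ (∀ v, 0 ≤ f v) ∧ ∀ v, f v = ∑ᶠ v', (G.weight v v' : ℂ).re * f v'}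

/-- The set `ℋ_∂⁺(G)` of extremal positive harmonic functions. -/
def extremalPositiveHarmonic (G : GradedGraph k W) : Set (W → ℝ) :=
  {f | f ∈ Set.extremePoints ℝ G.harmonic ∧ ∀ v, 0 < f v}

end GradedGraph

/-! ### The expansion of a finite graph -/

namespace FinGraph

variable {k : Subfield ℂ} {m : ℕ} {V : Type*}

/-- The vertices `(v_i, z^β, ℓ)` of the expansion: those obtained from `(v₀, 1, 0)` by following the
arrows `v_i → v_j` of `Γ`, one for each monomial `z^δ` appearing in `a_{j,i}`. -/
inductive Reachable (Γ : FinGraph k m V) (v₀ : V) : V × (Fin m → ℤ) × ℕ → Prop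
  | root : Reachable Γ v₀ (v₀, 0, 0)
  | step (i j : V) (β δ : Fin m → ℤ) (l : ℕ) (h : Reachable Γ v₀ (i, β, l))
      (hδ : (Γ.adj j i).coeff δ ≠ 0) : Reachable Γ v₀ (j, β + δ, l + 1)

/-- The vertex set of the expansion `Γ_e`. -/
def ExpVertex (Γ : FinGraph k m V) (v₀ : V) : Type _ :=
  {x : V × (Fin m → ℤ) × ℕ // Γ.Reachable v₀ x}

/-- The expansion `Γ_e`. The arrow from `(v_i, z^β, ℓ)` to `(v_j, z^β', ℓ + 1)` is weighted by the
coefficient of `z^(β' - β)` in `a_{j,i}`. -/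
def expansion [Finite V] (Γ : FinGraph k m V) (v₀ : V) : GradedGraph k (Γ.ExpVertex v₀) where
  root := ⟨(v₀, 0, 0), Reachable.root⟩
  rank x := x.1.2.2
  weight x y := if y.1.2.2 = x.1.2.2 + 1 then (Γ.adj y.1.1 x.1.1).coeff (y.1.2.1 - x.1.2.1) else 0
  rank_root := rfl
  nonneg x y := by
    split_ifs
    · exact Γ.nonneg _ _ _
    · simp [IsNonnegReal]
  rank_succ x y h := by
    by_contra hne
    exact h (if_neg hne)
  finite x := by
    have hfin : (⋃ j : V, (fun δ : Fin m → ℤ => (j, x.1.2.1 + δ, x.1.2.2 + 1)) ''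
        ((Γ.adj j x.1.1).coeff.support : Set (Fin m → ℤ))).Finite :=
      Set.finite_iUnion fun j => (Finset.finite_toSet _).image _
    refine Set.Finite.subset (hfin.preimage (f := Subtype.val) Subtype.val_injective.injOn) ?_
    intro y hy
    have hy' : (if y.1.2.2 = x.1.2.2 + 1 then (Γ.adj y.1.1 x.1.1).coeff (y.1.2.1 - x.1.2.1)
      else 0) ≠ 0 := hy
    have hl : y.1.2.2 = x.1.2.2 + 1 := by
      by_contra hne
      exact hy' (if_neg hne)
    rw [if_pos hl] at hy'
    simp only [Set.mem_preimage, Set.mem_iUnion, Set.mem_image]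
    refine ⟨y.1.1, y.1.2.1 - x.1.2.1, by simpa using hy', ?_⟩
    ext <;> simp [hl]

end FinGraph

/-! ### Perron–Frobenius vectors and the functions `f_t` -/

/-- `π` is the left Perron–Frobenius vector of the real matrix `M`, normalized by `π_{v₀} = 1`: it
has positive entries and is a left eigenvector for the eigenvalue of largest modulus. -/
def IsLeftPerronFrobenius {V : Type*} [Fintype V] [DecidableEq V] (M : Matrix V V ℝ) (v₀ : V)
    (π : V → ℝ) : Prop :=
  π v₀ = 1 ∧ (∀ i, 0 < π i) ∧ ∃ ρ : ℝ, Matrix.vecMul π M = ρ • π ∧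
    ∀ μ ∈ spectrum ℂ (M.map ((↑) : ℝ → ℂ)), ‖μ‖ ≤ ρ

/-- The function `f_t(v_i, z^β, q^ℓ) = t^β s^ℓ π_i` on the vertices of the expansion, where
`s = (∑ i, a_{i,v₀}(t) π_i)⁻¹`. -/
def FinGraph.harmonicAt {k : Subfield ℂ} {m : ℕ} {V : Type*} [Fintype V] (Γ : FinGraph k m V)
    (v₀ : V) (t : Fin m → ℝ) (π : V → ℝ) : Γ.ExpVertex v₀ → ℝ :=
  fun x => monomialValue t x.1.2.1 * (∑ i, Γ.adjAt t i v₀ * π i)⁻¹ ^ x.1.2.2 * π x.1.1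

end

/-!
Extend a function `f` on the vertices of the expansion linearly to the algebra `𝒜_e`. Then `f` is
harmonic exactly when the extension is invariant under multiplication by `γ`, and the theorem rests
on the ring theorem of Kerov and Vershik (`GradedGraph.mem_extremePoints_iff_multiplicative`): a
positive harmonic function is extremal if and only if its extension is multiplicative.

* If `φ` is extremal and `u` is a vertex, `φ` dominates a positive multiple of the harmonic function
  `v ↦ φ(b_u b_v) / φ(b_u)`, because `b_u` occurs in some power of `γ`; extremality forces the two
  to coincide.
* If `φ` is multiplicative and `ψ` is a nonnegative harmonic function with `ψ(root) = 1` dominated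
  by a multiple of `φ`, then `ψ / φ` is bounded and harmonic for the weights rescaled by `φ`. An
  elementary argument in the style of Choquet and Deny, based on the commutativity of the algebra
  (`GradedGraph.shift_le_of_multiplicative`), shows that `ψ ≤ φ`. Hence `φ` is extremal.

It remains to identify the positive multiplicative functions. Given a left Perron–Frobenius vector
`π` of `A_t`, the vector of the values `∑ l, c_{i,j}^l(t) π_l`, for fixed `i`, is again a left
eigenvector since multiplication by `b_i` commutes with `A`. The eigenvalue being simple, this
vector is `π_i π`, which says that `f_t` is multiplicative (`IsPMBasis.evalBasis_mul`). Conversely,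
a positive multiplicative function restricts to a character of the monoid of the pairs `(β, ℓ)` for
which `(v₀, z^β, ℓ)` is a vertex. As `ℝ` is divisible, this character is of the form `t^β s^ℓ`, and
the values at the other vertices are then `t^β s^ℓ π_i` for some positive `π`
(`IsPMBasis.exists_eq_of_multiplicative`). Harmonicity says that `π` is an eigenvector of `A_t`.

That the span `𝒜_e` is closed under products follows from positivity: a triple is a vertex of the
expansion if and only if the corresponding basis element occurs in a power of `γ`, and there is no
cancellation in a product of two powers of `γ` (`IsPMBasis.reachable_of_repr_mul_ne_zero`).

The algebra `𝒜` enters the argument through an arbitrary `k[Z^{±1}]`-algebra `R` with a basis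
`b` subject to `IsPMBasis`.
-/

/-! ### Extension of additive characters -/

/-- An additive map to `ℝ` from a submonoid of an abelian group `G` extends to the whole group:
it extends to the differences of elements of the submonoid because `ℝ` is a group, and from there
because `ℝ` is divisible. The submonoid is given by an injective map `ι`. -/
theorem AddMonoidHom.exists_extension_real {M G : Type*} [AddCommMonoid M] [AddCommGroup G]
    (ι : M →+ G) (hι : Function.Injective ι) (g : M →+ ℝ) : ∃ L : G →+ ℝ, ∀ x, L (ι x) = g x := by
  let H : AddSubgroup G :=
    { carrier := {x | ∃ a b : M, x = ι a - ι b}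
      zero_mem' := ⟨0, 0, by simp⟩
      add_mem' := by
        rintro _ _ ⟨a, b, rfl⟩ ⟨c, d, rfl⟩
        exact ⟨a + c, b + d, by rw [map_add, map_add]; abel⟩
      neg_mem' := by
        rintro _ ⟨a, b, rfl⟩
        exact ⟨b, a, by abel⟩ }
  have hH : ∀ x : H, ∃ a b : M, (x : G) = ι a - ι b := fun x => x.2
  choose p n hpn using hH
  have key : ∀ (x : H) (a b : M), (x : G) = ι a - ι b → g (p x) - g (n x) = g a - g b := by
    intro x a b h
    rw [hpn x, sub_eq_sub_iff_add_eq_add, ← map_add, ← map_add] at h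
    have h2 := congrArg g (hι h)
    rw [map_add, map_add] at h2
    linarith
  let gH : H →+ ℝ := AddMonoidHom.mk' (fun x => g (p x) - g (n x)) fun x y => by
    rw [key (x + y) (p x + p y) (n x + n y)
      (by rw [AddSubgroup.coe_add, hpn x, hpn y, map_add, map_add]; abel), map_add, map_add]
    ring
  obtain ⟨L, hL⟩ := (Module.Baer.of_divisible ℝ).extension_property H.toIntSubmodule.subtype
    Subtype.val_injective gH.toIntLinearMap
  refine ⟨L.toAddMonoidHom, fun x => ?_⟩
  have h1 := LinearMap.congr_fun hL ⟨ι x, x, 0, by simp⟩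
  have h2 := key ⟨ι x, x, 0, by simp⟩ x 0 (by simp)
  rw [map_zero g] at h2
  exact h1.trans (h2.trans (sub_zero _))

/-! ### Perron–Frobenius theory for irreducible nonnegative matrices -/

namespace PerronFrobenius

variable {V : Type*} [Fintype V] [DecidableEq V] {M : Matrix V V ℝ}

theorem pow_nonneg_apply (hM : ∀ i j, 0 ≤ M i j) (n : ℕ) (i j : V) : 0 ≤ (M ^ n) i j := by
  induction n generalizing j with
  | zero => rw [pow_zero, Matrix.one_apply]; split_ifs <;> norm_num
  | succ n ih =>
    rw [pow_succ, Matrix.mul_apply]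
    exact Finset.sum_nonneg fun l _ => mul_nonneg (ih l) (hM l j)

theorem vecMul_pow {x : V → ℝ} {r : ℝ} (h : Matrix.vecMul x M = r • x) (n : ℕ) :
    Matrix.vecMul x (M ^ n) = r ^ n • x := by
  induction n with
  | zero => simp
  | succ n ih =>
    rw [pow_succ, ← Matrix.vecMul_vecMul, ih, Matrix.smul_vecMul, h, smul_smul, pow_succ]

theorem exists_pow_pos (hM : ∀ i j, 0 ≤ M i j)
    (hirr : ∀ i j, Relation.TransGen (fun a b => 0 < M a b) i j) (i j : V) :
    ∃ n, 0 < (M ^ n) i j := by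
  induction hirr i j with
  | single h => exact ⟨1, by simpa using h⟩
  | @tail b c _ h ih =>
    obtain ⟨n, hn⟩ := ih
    refine ⟨n + 1, ?_⟩
    rw [pow_succ, Matrix.mul_apply]
    exact Finset.sum_pos' (fun l _ => mul_nonneg (pow_nonneg_apply hM n i l) (hM l c))
      ⟨b, Finset.mem_univ _, mul_pos hn h⟩

/-- A nonnegative left eigenvector of an irreducible matrix which has a zero entry vanishes. -/
theorem eq_zero_of_apply_eq_zero (hM : ∀ i j, 0 ≤ M i j)
    (hirr : ∀ i j, Relation.TransGen (fun a b => 0 < M a b) i j) {z : V → ℝ} {r : ℝ}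
    (hz : ∀ i, 0 ≤ z i) (h : Matrix.vecMul z M = r • z) {i : V} (hi : z i = 0) : z = 0 := by
  funext j
  obtain ⟨n, hn⟩ := exists_pow_pos hM hirr j i
  have h1 := congrFun (vecMul_pow h n) i
  simp only [Pi.smul_apply, hi, smul_zero] at h1
  rw [Matrix.vecMul, dotProduct, Finset.sum_eq_zero_iff_of_nonneg
    fun l _ => mul_nonneg (hz l) (pow_nonneg_apply hM n l i)] at h1
  exact (mul_eq_zero.mp (h1 j (Finset.mem_univ _))).resolve_right hn.ne'

/-- The eigenvalue of a positive left eigenvector of an irreducible matrix is simple. -/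
theorem eq_smul_of_vecMul_eq [Nonempty V] (hM : ∀ i j, 0 ≤ M i j)
    (hirr : ∀ i j, Relation.TransGen (fun a b => 0 < M a b) i j) {x y : V → ℝ} {r : ℝ}
    (hx : ∀ i, 0 < x i) (hxM : Matrix.vecMul x M = r • x) (hyM : Matrix.vecMul y M = r • y) :
    ∃ c : ℝ, y = c • x := by
  obtain ⟨i, hi⟩ := Finite.exists_min fun i => y i / x i
  refine ⟨y i / x i, ?_⟩
  have h := eq_zero_of_apply_eq_zero hM hirr (z := y - (y i / x i) • x) (r := r) (i := i)
    (fun j => by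
      have := (le_div_iff₀ (hx j)).mp (hi j)
      simpa using this)
    (by rw [Matrix.sub_vecMul, Matrix.smul_vecMul, hxM, hyM, smul_sub, smul_comm])
    (by simp [(hx i).ne'])
  exact sub_eq_zero.mp h

/-- Existence of a positive left eigenvector: in the simplex, a vector `x` for which the largest `r`
with `r x ≤ x M` is as large as possible is an eigenvector, as otherwise its image under a positive
polynomial in `M` would allow a larger `r`. -/
theorem exists_pos_eigenvector [Nonempty V] (hM : ∀ i j, 0 ≤ M i j)
    (hirr : ∀ i j, Relation.TransGen (fun a b => 0 < M a b) i j) :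
    ∃ (x : V → ℝ) (r : ℝ), (∀ i, 0 < x i) ∧ Matrix.vecMul x M = r • x := by
  choose n hn using exists_pow_pos hM hirr
  -- `P` is a polynomial in `M` with positive entries.
  set P : Matrix V V ℝ := ∑ i, ∑ j, M ^ n i j with hP
  have hPpos : ∀ i j, 0 < P i j := by
    intro i j
    rw [hP]
    simp only [Matrix.sum_apply]
    refine Finset.sum_pos' (fun a _ => Finset.sum_nonneg fun b _ => pow_nonneg_apply hM _ _ _)
      ⟨i, Finset.mem_univ _, ?_⟩
    exact Finset.sum_pos' (fun b _ => pow_nonneg_apply hM _ _ _) ⟨j, Finset.mem_univ _, hn i j⟩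
  have hcomm : P * M = M * P := by
    rw [hP, Finset.sum_mul, Finset.mul_sum]
    refine Finset.sum_congr rfl fun i _ => ?_
    rw [Finset.sum_mul, Finset.mul_sum]
    exact Finset.sum_congr rfl fun j _ => ((Commute.refl M).pow_left _).eq
  have hvpos : ∀ y : V → ℝ, (∀ i, 0 ≤ y i) → y ≠ 0 → ∀ i, 0 < Matrix.vecMul y P i := by
    intro y hy hne i
    obtain ⟨j, hj⟩ := Function.ne_iff.mp hne
    exact Finset.sum_pos' (fun l _ => mul_nonneg (hy l) (hPpos l i).le)
      ⟨j, Finset.mem_univ _, mul_pos (lt_of_le_of_ne (hy j) (Ne.symm hj)) (hPpos j i)⟩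
  -- Any admissible `r` is at most the sum `R` of all entries of `M`.
  set R : ℝ := ∑ j, ∑ i, M i j with hR
  have hRb : ∀ x ∈ stdSimplex ℝ V, ∀ r : ℝ, (∀ i, r * x i ≤ Matrix.vecMul x M i) → r ≤ R := by
    intro x hx r h
    have h1 : ∑ i, r * x i ≤ ∑ i, Matrix.vecMul x M i := Finset.sum_le_sum fun i _ => h i
    rw [← Finset.mul_sum, hx.2, mul_one] at h1
    refine h1.trans (Finset.sum_le_sum fun j _ => Finset.sum_le_sum fun i _ => ?_)
    have : x i ≤ 1 := by
      rw [← hx.2]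
      exact Finset.single_le_sum (fun a _ => hx.1 a) (Finset.mem_univ i)
    nlinarith [hM i j, hx.1 i]
  let S : Set ((V → ℝ) × ℝ) :=
    (stdSimplex ℝ V ×ˢ Set.Icc 0 R) ∩ {p | ∀ i, p.2 * p.1 i ≤ Matrix.vecMul p.1 M i}
  have hS : IsCompact S := by
    refine ((isCompact_stdSimplex ℝ V).prod isCompact_Icc).inter_right ?_
    simp only [Set.ofPred_forall]
    refine isClosed_iInter fun i => isClosed_le (by fun_prop) ?_
    simp only [Matrix.vecMul, dotProduct]
    fun_prop
  have hSne : S.Nonempty := by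
    classical
    obtain ⟨i⟩ := ‹Nonempty V›
    refine ⟨(Pi.single i 1, 0), ⟨single_mem_stdSimplex ℝ i, le_refl _, ?_⟩, fun j => ?_⟩
    · exact Finset.sum_nonneg fun j _ => Finset.sum_nonneg fun i _ => hM i j
    · simpa using hM i j
  obtain ⟨⟨x, r⟩, ⟨⟨hx, hr⟩, hle⟩, hmax⟩ := hS.exists_isMaxOn hSne continuousOn_snd
  simp only at hx hr hle
  have hx0 : x ≠ 0 := by
    rintro rfl
    simpa using hx.2
  have heig : Matrix.vecMul x M = r • x := by
    by_contra hne
    -- `y P` is positive, so that `x' = x P` satisfies `(r + ε) x' ≤ x' M` for some `ε > 0`.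
    set y := Matrix.vecMul x M - r • x with hy
    have hy1 := hvpos y (fun i => by simpa [hy] using hle i) (sub_ne_zero.mpr hne)
    have hx1 := hvpos x hx.1 hx0
    set x' := Matrix.vecMul x P with hx'
    have hyx : Matrix.vecMul y P = Matrix.vecMul x' M - r • x' := by
      rw [hy, Matrix.sub_vecMul, Matrix.smul_vecMul, Matrix.vecMul_vecMul, ← hcomm,
        ← Matrix.vecMul_vecMul]
    obtain ⟨i₀, hi₀⟩ := Finite.exists_min fun i => Matrix.vecMul y P i / x' i
    set ε := Matrix.vecMul y P i₀ / x' i₀ with hε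
    have hεpos : 0 < ε := div_pos (hy1 i₀) (hx1 i₀)
    have hsum : 0 < ∑ i, x' i := Finset.sum_pos (fun i _ => hx1 i) Finset.univ_nonempty
    set c := (∑ i, x' i)⁻¹ with hc
    have hcpos : 0 < c := inv_pos.mpr hsum
    have hmem : c • x' ∈ stdSimplex ℝ V := by
      refine ⟨fun i => mul_nonneg hcpos.le (hx1 i).le, ?_⟩
      simp only [Pi.smul_apply, smul_eq_mul, ← Finset.mul_sum]
      exact inv_mul_cancel₀ hsum.ne'
    have hle' : ∀ i, (r + ε) * (c • x') i ≤ Matrix.vecMul (c • x') M i := by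
      intro i
      have h1 := (le_div_iff₀ (hx1 i)).mp (hi₀ i)
      have h2 : Matrix.vecMul y P i = Matrix.vecMul x' M i - r * x' i := by
        rw [hyx]; simp
      rw [Matrix.smul_vecMul]
      simp only [Pi.smul_apply, smul_eq_mul]
      nlinarith
    have := hmax (a := (c • x', r + ε)) ⟨⟨hmem, add_nonneg hr.1 hεpos.le, hRb _ hmem _ hle'⟩, hle'⟩
    simp only [Set.mem_ofPred_eq] at this
    linarith
  refine ⟨x, r, fun i => lt_of_le_of_ne (hx.1 i) fun h => hx0 ?_, heig⟩
  exact eq_zero_of_apply_eq_zero hM hirr hx.1 heig h.symm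

/-- The eigenvalue of a positive left eigenvector of a nonnegative matrix bounds all eigenvalues:
pair the entrywise modulus of a right eigenvector with the positive left eigenvector. -/
theorem norm_le_of_mem_spectrum (hM : ∀ i j, 0 ≤ M i j) {x : V → ℝ} {r : ℝ}
    (hx : ∀ i, 0 < x i) (hxM : Matrix.vecMul x M = r • x) {μ : ℂ}
    (hμ : μ ∈ spectrum ℂ (M.map ((↑) : ℝ → ℂ))) : ‖μ‖ ≤ r := by
  rw [← Matrix.spectrum_toLin', ← Module.End.hasEigenvalue_iff_mem_spectrum] at hμ
  obtain ⟨v, hv⟩ := hμ.exists_hasEigenvector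
  have hv1 := hv.apply_eq_smul
  rw [Matrix.toLin'_apply] at hv1
  have h1 : ∀ i, ‖μ‖ * ‖v i‖ ≤ ∑ j, M i j * ‖v j‖ := by
    intro i
    have := congrFun hv1 i
    rw [← norm_mul, ← smul_eq_mul, ← Pi.smul_apply, ← this, Matrix.mulVec, dotProduct]
    refine (norm_sum_le _ _).trans (Finset.sum_le_sum fun j _ => ?_)
    simp [abs_of_nonneg (hM i j)]
  have h2 : ∑ i, x i * (‖μ‖ * ‖v i‖) ≤ ∑ i, x i * ∑ j, M i j * ‖v j‖ :=
    Finset.sum_le_sum fun i _ => mul_le_mul_of_nonneg_left (h1 i) (hx i).le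
  have h3 : ∑ i, x i * ∑ j, M i j * ‖v j‖ = r * ∑ j, x j * ‖v j‖ := by
    simp only [Finset.mul_sum]
    rw [Finset.sum_comm]
    refine Finset.sum_congr rfl fun j _ => ?_
    have := congrFun hxM j
    simp only [Matrix.vecMul, dotProduct, Pi.smul_apply, smul_eq_mul] at this
    rw [← mul_assoc, ← this, Finset.sum_mul]
    exact Finset.sum_congr rfl fun i _ => by ring
  have h4 : ∑ i, x i * (‖μ‖ * ‖v i‖) = ‖μ‖ * ∑ j, x j * ‖v j‖ := by
    rw [Finset.mul_sum]
    exact Finset.sum_congr rfl fun i _ => by ring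
  obtain ⟨i, hi⟩ := Function.ne_iff.mp hv.2
  have h5 : 0 < ∑ j, x j * ‖v j‖ :=
    Finset.sum_pos' (fun j _ => mul_nonneg (hx j).le (norm_nonneg _))
      ⟨i, Finset.mem_univ _, mul_pos (hx i) (norm_pos_iff.mpr hi)⟩
  rw [h4, h3] at h2
  exact le_of_mul_le_mul_right h2 h5

/-- Two positive left eigenvectors of an irreducible matrix have the same eigenvalue, hence are
proportional. -/
theorem eq_smul_of_pos [Nonempty V] (hM : ∀ i j, 0 ≤ M i j)
    (hirr : ∀ i j, Relation.TransGen (fun a b => 0 < M a b) i j) {x y : V → ℝ} {r s : ℝ}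
    (hx : ∀ i, 0 < x i) (hxM : Matrix.vecMul x M = r • x)
    (hy : ∀ i, 0 < y i) (hyM : Matrix.vecMul y M = s • y) : ∃ c : ℝ, y = c • x := by
  -- The right Perron vector of `M` pairs positively with both vectors.
  have hirr' : ∀ i j, Relation.TransGen (fun a b => 0 < M.transpose a b) i j := fun i j =>
    (Relation.transGen_swap (r := fun a b => 0 < M a b)).mpr (hirr j i)
  obtain ⟨u, ρ, hu, huM⟩ := exists_pos_eigenvector (M := M.transpose) (fun i j => hM j i) hirr'
  rw [Matrix.vecMul_transpose] at huM
  have key : ∀ {z : V → ℝ} {q : ℝ}, (∀ i, 0 < z i) → Matrix.vecMul z M = q • z → q = ρ := by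
    intro z q hz hzM
    have h : Matrix.vecMul z M ⬝ᵥ u = z ⬝ᵥ M.mulVec u := (Matrix.dotProduct_mulVec z M u).symm
    rw [hzM, huM, smul_dotProduct, dotProduct_smul] at h
    have hpos : 0 < z ⬝ᵥ u :=
      Finset.sum_pos (fun i _ => mul_pos (hz i) (hu i)) Finset.univ_nonempty
    exact mul_right_cancel₀ hpos.ne' h
  rw [key hx hxM] at hxM
  rw [key hy hyM] at hyM
  exact eq_smul_of_vecMul_eq hM hirr hx hxM hyM

end PerronFrobenius

noncomputable section

/-! ### Extremal harmonic functions and multiplicative functions -/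

namespace GradedGraph

section Functional

variable {k : Subfield ℂ} {W 𝔸 : Type*} [Ring 𝔸] [Algebra k 𝔸] (B : Module.Basis W k 𝔸)

/-- The `k`-linear functional on `𝔸` that takes the value `f v` on the basis element `B v`. -/
def functional (f : W → ℝ) : 𝔸 →ₗ[k] ℂ := B.constr k fun v => (f v : ℂ)

@[simp] theorem functional_basis (f : W → ℝ) (v : W) : functional B f (B v) = f v := by
  simp [functional]

theorem functional_apply (f : W → ℝ) (x : 𝔸) :
    functional B f x = (B.repr x).sum fun w c => (c : ℂ) * f w := by
  simp [functional, Module.Basis.constr_apply, Subfield.smul_def]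

theorem functional_sub (f g : W → ℝ) (x : 𝔸) :
    functional B (f - g) x = functional B f x - functional B g x := by
  simp [functional_apply, Finsupp.sum, mul_sub]

theorem functional_smul (a : ℝ) (f : W → ℝ) (x : 𝔸) :
    functional B (a • f) x = a * functional B f x := by
  simp only [functional_apply, Finsupp.sum, Pi.smul_apply, smul_eq_mul, Complex.ofReal_mul,
    Finset.mul_sum]
  exact Finset.sum_congr rfl fun w _ => by ring

/-- The operator `f ↦ (v ↦ f(B u * B v))`, where `f` is extended linearly from the basis `B`; the
real parts of the structure constants are used so that the values are real by construction. -/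
def shift (u : W) : (W → ℝ) →ₗ[ℝ] (W → ℝ) where
  toFun f v := (B.repr (B u * B v)).sum fun w c => (c : ℂ).re * f w
  map_add' f g := by
    funext v
    simp [Finsupp.sum, mul_add, Finset.sum_add_distrib]
  map_smul' a f := by
    funext v
    simp only [Finsupp.sum, Pi.smul_apply, smul_eq_mul, Finset.mul_sum, RingHom.id_apply]
    exact Finset.sum_congr rfl fun w _ => by ring

theorem shift_apply (u : W) (f : W → ℝ) (v : W) :
    shift B u f v = (B.repr (B u * B v)).sum fun w c => (c : ℂ).re * f w := rfl

variable {B}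

theorem shift_mono (hB : ∀ u v w, IsNonnegReal (B.repr (B u * B v) w)) (u : W) {f g : W → ℝ}
    (h : ∀ v, f v ≤ g v) (v : W) : shift B u f v ≤ shift B u g v :=
  Finset.sum_le_sum fun w _ => mul_le_mul_of_nonneg_left (h w) (hB u v w).1

theorem ofReal_shift (hB : ∀ u v w, IsNonnegReal (B.repr (B u * B v) w)) (u : W) (f : W → ℝ)
    (v : W) : (shift B u f v : ℂ) = functional B f (B u * B v) := by
  rw [functional_apply, shift_apply, Finsupp.sum, Complex.ofReal_sum]
  refine Finset.sum_congr rfl fun w _ => ?_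
  rw [Complex.ofReal_mul]
  congr 1
  exact Complex.ext rfl (hB u v w).2.symm

theorem functional_shift (hB : ∀ u v w, IsNonnegReal (B.repr (B u * B v) w)) (u : W) (f : W → ℝ)
    (x : 𝔸) : functional B (shift B u f) x = functional B f (B u * x) := by
  have : functional B (shift B u f) = (functional B f).comp (LinearMap.mulLeft k (B u)) :=
    B.ext fun v => by simp [ofReal_shift hB]
  exact LinearMap.congr_fun this x

end Functional

variable {k : Subfield ℂ} {W 𝔸 : Type*} [Ring 𝔸] [Algebra k 𝔸] {B : Module.Basis W k 𝔸}
  {G : GradedGraph k W}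

/-- The element `γ`, the sum of the basis elements of the successors of the root, weighted by the
arrows from the root. -/
def gamma (G : GradedGraph k W) (B : Module.Basis W k 𝔸) : 𝔸 :=
  ∑ᶠ v', G.weight G.root v' • B v'

/-- For a multiplicative graph, harmonicity of `f` means that its linear extension is invariant
under multiplication by `γ`. -/
theorem harmonic_iff_functional (hG : G.IsPositivelyMultiplicative B) (f : W → ℝ) :
    (∀ v, f v = ∑ᶠ v', (G.weight v v' : ℂ).re * f v') ↔
      ∀ x, functional B f (G.gamma B * x) = functional B f x := by
  have key : ∀ v, functional B f (G.gamma B * B v) =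
      ((∑ᶠ v', (G.weight v v' : ℂ).re * f v' : ℝ) : ℂ) := by
    intro v
    rw [gamma, hG.gamma_mul v,
      finsum_eq_sum_of_support_subset (s := (G.finite v).toFinset) _ (fun w hw => by
        simp only [Set.Finite.coe_toFinset, Function.mem_support] at hw ⊢
        exact left_ne_zero_of_smul hw),
      finsum_eq_sum_of_support_subset (s := (G.finite v).toFinset) _ (fun w hw => by
        simp only [Set.Finite.coe_toFinset, Function.mem_support] at hw ⊢
        intro h0
        simp [h0] at hw),
      map_sum, Complex.ofReal_sum]
    refine Finset.sum_congr rfl fun w _ => ?_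
    rw [map_smul, functional_basis, Complex.ofReal_mul, Subfield.smul_def, smul_eq_mul]
    congr 1
    exact Complex.ext rfl (G.nonneg v w).2
  constructor
  · intro h x
    have : (functional B f).comp (LinearMap.mulLeft k (G.gamma B)) = functional B f :=
      B.ext fun v => by
        rw [LinearMap.comp_apply, LinearMap.mulLeft_apply, key, ← h v, functional_basis]
    exact LinearMap.congr_fun this x
  · intro h v
    have := key v
    rw [h, functional_basis] at this
    exact_mod_cast this

theorem functional_gamma_pow {f : W → ℝ}
    (hf : ∀ x, functional B f (G.gamma B * x) = functional B f x) (n : ℕ) (x : 𝔸) :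
    functional B f (G.gamma B ^ n * x) = functional B f x := by
  induction n with
  | zero => simp
  | succ n ih => rw [pow_succ', mul_assoc, hf, ih]

theorem functional_shift_gamma (hG : G.IsPositivelyMultiplicative B)
    (hcomm : ∀ x y : 𝔸, x * y = y * x) (u : W) {f : W → ℝ}
    (hf : ∀ x, functional B f (G.gamma B * x) = functional B f x) (x : 𝔸) :
    functional B (shift B u f) (G.gamma B * x) = functional B (shift B u f) x := by
  rw [functional_shift hG.structure_nonneg, functional_shift hG.structure_nonneg, ← mul_assoc,
    hcomm (B u), mul_assoc, hf]

/-- If `B u` occurs in `γ ^ n` with coefficient `c`, then `c` times the shift by `u` of a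
nonnegative harmonic function is bounded by this function: it is one of the terms in the expansion
of `f(γ ^ n b_v) = f(v)`. -/
theorem coeff_mul_shift_le (hG : G.IsPositivelyMultiplicative B) {n : ℕ}
    (hn : ∀ w, IsNonnegReal (B.repr (G.gamma B ^ n) w)) (u : W) {f : W → ℝ} (hf0 : ∀ v, 0 ≤ f v)
    (hf : ∀ x, functional B f (G.gamma B * x) = functional B f x) (v : W) :
    (B.repr (G.gamma B ^ n) u : ℂ).re * shift B u f v ≤ f v := by
  have h1 : f v = (B.repr (G.gamma B ^ n)).sum fun w c => (c : ℂ).re * shift B w f v := by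
    have h2 : (f v : ℂ) = functional B f (G.gamma B ^ n * B v) := by
      rw [functional_gamma_pow hf, functional_basis]
    have h3 := B.linearCombination_repr (G.gamma B ^ n)
    rw [Finsupp.linearCombination_apply, Finsupp.sum] at h3
    have h4 : functional B f (G.gamma B ^ n * B v) =
        (((B.repr (G.gamma B ^ n)).sum fun w c => (c : ℂ).re * shift B w f v : ℝ) : ℂ) := by
      conv_lhs => rw [← h3]
      rw [Finset.sum_mul, map_sum, Finsupp.sum, Complex.ofReal_sum]
      refine Finset.sum_congr rfl fun w _ => ?_
      rw [smul_mul_assoc, map_smul, Complex.ofReal_mul, ofReal_shift hG.structure_nonneg,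
        Subfield.smul_def, smul_eq_mul]
      congr 1
      exact Complex.ext rfl (hn w).2
    exact_mod_cast h2.trans h4
  have hs : ∀ w, 0 ≤ shift B w f v := fun w => by
    simpa using shift_mono hG.structure_nonneg w (f := 0) hf0 v
  conv_rhs => rw [h1]
  by_cases hu : u ∈ (B.repr (G.gamma B ^ n)).support
  · exact Finset.single_le_sum (f := fun w => (B.repr (G.gamma B ^ n) w : ℂ).re * shift B w f v)
      (fun w _ => mul_nonneg (hn w).1 (hs w)) hu
  · rw [Finsupp.notMem_support_iff.mp hu]
    simp only [ZeroMemClass.coe_zero, Complex.zero_re, zero_mul]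
    exact Finset.sum_nonneg fun w _ => mul_nonneg (hn w).1 (hs w)


/-- The key step for the extremality of multiplicative functions, an argument in the style of
Choquet and Deny. If `ψ` is a nonnegative harmonic function dominated by a multiple of the
multiplicative function `φ`, the normalized shift `T` by `u` satisfies `T ψ ≤ ψ`: wherever
`(T ψ - ψ) / φ` is close to its supremum `M`, so are its images under the first `N` powers of `T`,
whence `T ^ N ψ - ψ` is nearly `N M φ` there, while it is bounded by a multiple of `φ` independent
of `N`. -/
theorem shift_le_of_multiplicative (hG : G.IsPositivelyMultiplicative B)
    (hcomm : ∀ x y : 𝔸, x * y = y * x) {n : ℕ}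
    (hn : ∀ w, IsNonnegReal (B.repr (G.gamma B ^ n) w)) {u : W}
    (hu : B.repr (G.gamma B ^ n) u ≠ 0) {φ ψ : W → ℝ} (hφ0 : ∀ v, 0 < φ v)
    (hφ : ∀ x, functional B φ (G.gamma B * x) = functional B φ x)
    (hmul : ∀ v, shift B u φ v = φ u * φ v) (hψ0 : ∀ v, 0 ≤ ψ v)
    (hψ : ∀ x, functional B ψ (G.gamma B * x) = functional B ψ x) {C : ℝ}
    (hC : ∀ v, ψ v ≤ C * φ v) (v₁ : W) : shift B u ψ v₁ ≤ φ u * ψ v₁ := by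
  have hB := hG.structure_nonneg
  set T : Module.End ℝ (W → ℝ) := (φ u)⁻¹ • shift B u with hT
  have hTapp : ∀ f v, T f v = (φ u)⁻¹ * shift B u f v := fun f v => rfl
  have hTφ : ∀ a : ℝ, T (a • φ) = a • φ := by
    intro a
    rw [map_smul]
    congr 1
    funext v
    rw [hTapp, hmul, inv_mul_cancel_left₀ (hφ0 u).ne']
  have hTmono : ∀ {f g : W → ℝ}, (∀ v, f v ≤ g v) → ∀ v, T f v ≤ T g v := fun h v =>
    mul_le_mul_of_nonneg_left (shift_mono hB u h v) (inv_nonneg.mpr (hφ0 u).le)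
  have hTinv : ∀ {f : W → ℝ}, (∀ x, functional B f (G.gamma B * x) = functional B f x) →
      ∀ x, functional B (T f) (G.gamma B * x) = functional B (T f) x := fun h x => by
    rw [hT, LinearMap.smul_apply, functional_smul, functional_smul,
      functional_shift_gamma hG hcomm u h]
  set p : ℝ := (B.repr (G.gamma B ^ n) u : ℂ).re * φ u with hp
  have hc : 0 < (B.repr (G.gamma B ^ n) u : ℂ).re := by
    refine lt_of_le_of_ne (hn u).1 fun h => hu ?_
    exact Subtype.ext (Complex.ext h.symm (hn u).2)
  have hp0 : 0 < p := mul_pos hc (hφ0 u)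
  -- `coeff_mul_shift_le` for the nonnegative harmonic function `M φ - f`: where `f` is close to
  -- the upper bound `M φ`, so is `T f`.
  have step : ∀ (M : ℝ) (f : W → ℝ), (∀ x, functional B f (G.gamma B * x) = functional B f x) →
      (∀ v, f v ≤ M * φ v) → ∀ v, p * (M * φ v - T f v) ≤ M * φ v - f v := by
    intro M f hf hfM v
    have := coeff_mul_shift_le hG hn u (f := M • φ - f) (fun w => by simpa using hfM w)
      (fun x => by
        rw [functional_sub, functional_sub, functional_smul, functional_smul, hφ, hf]) v
    rw [map_sub, map_smul] at this
    simp only [Pi.sub_apply, Pi.smul_apply, smul_eq_mul, hmul] at this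
    rw [hTapp, hp]
    have h2 := (hφ0 u).ne'
    calc _ = (B.repr (G.gamma B ^ n) u : ℂ).re * (M * (φ u * φ v) - shift B u f v) := by
            field_simp
      _ ≤ _ := this
  have hpow : ∀ (M : ℝ) (f : W → ℝ), (∀ x, functional B f (G.gamma B * x) = functional B f x) →
      (∀ v, f v ≤ M * φ v) → ∀ j : ℕ,
      (∀ x, functional B ((T ^ j) f) (G.gamma B * x) = functional B ((T ^ j) f) x) ∧
      (∀ v, (T ^ j) f v ≤ M * φ v) ∧
      ∀ v, M * φ v - (T ^ j) f v ≤ (p⁻¹) ^ j * (M * φ v - f v) := by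
    intro M f hf hfM j
    induction j with
    | zero => exact ⟨hf, hfM, fun v => by simp⟩
    | succ j ih =>
      obtain ⟨h1, h2, h3⟩ := ih
      rw [pow_succ', Module.End.mul_apply]
      refine ⟨hTinv h1, fun v => ?_, fun v => ?_⟩
      · have := hTmono (g := M • φ) h2 v
        rwa [hTφ] at this
      · have h4 := step M _ h1 h2 v
        rw [pow_succ', mul_assoc]
        calc _ = p⁻¹ * (p * (M * φ v - T ((T ^ j) f) v)) := by
              rw [inv_mul_cancel_left₀ hp0.ne']
          _ ≤ _ := mul_le_mul_of_nonneg_left (h4.trans (h3 v)) (inv_nonneg.mpr hp0.le)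
  set g : W → ℝ := T ψ - ψ with hg
  have hginv : ∀ x, functional B g (G.gamma B * x) = functional B g x := fun x => by
    rw [hg, functional_sub, functional_sub, hTinv hψ, hψ]
  have hgC : ∀ v, g v ≤ C * φ v := fun v => by
    have h1 : T ψ v ≤ C * φ v := by simpa using (hpow C ψ hψ hC 1).2.1 v
    have h2 := hψ0 v
    simp only [hg, Pi.sub_apply]
    linarith
  have hbdd : BddAbove (Set.range fun v => g v / φ v) :=
    ⟨C, by rintro _ ⟨v, rfl⟩; exact (div_le_iff₀ (hφ0 v)).mpr (hgC v)⟩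
  set M : ℝ := ⨆ v, g v / φ v with hM
  have hgM : ∀ v, g v ≤ M * φ v := fun v => (div_le_iff₀ (hφ0 v)).mp (le_ciSup hbdd v)
  have : Nonempty W := ⟨u⟩
  have hM0 : M ≤ 0 := by
    by_contra! hMpos
    obtain ⟨N, hN⟩ := exists_nat_gt (C / M)
    have hNM : C < N * M := (div_lt_iff₀ hMpos).mp hN
    set S : ℝ := ∑ j ∈ Finset.range (N + 1), (p⁻¹) ^ j with hS
    have hSpos : 0 < S := Finset.sum_pos (fun j _ => by positivity) ⟨0, by simp⟩
    -- The telescoping sum for `T ^ (N + 1) ψ - ψ` keeps `g / φ` away from its supremum.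
    have hlt : M ≤ M - (N * M + M - C) / S := by
      refine ciSup_le fun v => ?_
      have h1 : (T ^ (N + 1)) ψ - ψ = ∑ j ∈ Finset.range (N + 1), (T ^ j) g := by
        have := congrArg (fun F : Module.End ℝ (W → ℝ) => F ψ) (geom_sum_mul T (N + 1))
        simp only [Module.End.mul_apply, LinearMap.sub_apply, Module.End.one_apply,
          LinearMap.sum_apply] at this
        exact this.symm
      have h2 := congrFun h1 v
      rw [Pi.sub_apply, Finset.sum_apply] at h2
      have h3 : ∑ j ∈ Finset.range (N + 1), (M * φ v - (p⁻¹) ^ j * (M * φ v - g v)) ≤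
          ∑ j ∈ Finset.range (N + 1), (T ^ j) g v :=
        Finset.sum_le_sum fun j _ => by
          have := (hpow M g hginv hgM j).2.2 v
          linarith
      rw [Finset.sum_sub_distrib, Finset.sum_const, Finset.card_range, nsmul_eq_mul,
        ← Finset.sum_mul, ← hS] at h3
      have h4 := (hpow C ψ hψ hC (N + 1)).2.1 v
      have h5 := hψ0 v
      push_cast at h3
      have h6 : (N * M + M - C) * φ v ≤ S * (M * φ v - g v) := by linarith
      have h7 := hφ0 v
      rw [div_le_iff₀ h7, sub_mul, div_mul_eq_mul_div, le_sub_comm, div_le_iff₀ hSpos]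
      linarith
    have : 0 < (N * M + M - C) / S := div_pos (by linarith) hSpos
    linarith
  have h1 := (hgM v₁).trans (mul_nonpos_of_nonpos_of_nonneg hM0 (hφ0 v₁).le)
  simp only [hg, Pi.sub_apply, hTapp] at h1
  rw [sub_nonpos, inv_mul_le_iff₀ (hφ0 u)] at h1
  exact h1

theorem shift_root (hG : G.IsPositivelyMultiplicative B) (u : W) (f : W → ℝ) :
    shift B u f G.root = f u := by
  have := ofReal_shift hG.structure_nonneg u f G.root
  rw [hG.root_eq_one, mul_one, functional_basis] at this
  exact_mod_cast this

/-- **Ring theorem of Kerov and Vershik** for positive functions: on a commutative positively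
multiplicative graph, each vertex of which occurs in some power of `γ`, a positive
harmonic function is extremal if and only if its linear extension is multiplicative. -/
theorem mem_extremePoints_iff_multiplicative (hG : G.IsPositivelyMultiplicative B)
    (hcomm : ∀ x y : 𝔸, x * y = y * x)
    (hocc : ∀ u, ∃ n : ℕ, (∀ w, IsNonnegReal (B.repr (G.gamma B ^ n) w)) ∧
      B.repr (G.gamma B ^ n) u ≠ 0)
    {φ : W → ℝ} (hφ : φ ∈ G.harmonic) (hpos : ∀ v, 0 < φ v) :
    φ ∈ Set.extremePoints ℝ G.harmonic ↔ ∀ u v, shift B u φ v = φ u * φ v := by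
  have hφi := (harmonic_iff_functional hG φ).mp hφ.2.2
  constructor
  · intro hext u
    obtain ⟨n, hn, hu⟩ := hocc u
    have hc : 0 < (B.repr (G.gamma B ^ n) u : ℂ).re := by
      refine lt_of_le_of_ne (hn u).1 fun h => hu ?_
      exact Subtype.ext (Complex.ext h.symm (hn u).2)
    set T : W → ℝ := (φ u)⁻¹ • shift B u φ with hT
    have hTi : ∀ x, functional B T (G.gamma B * x) = functional B T x := fun x => by
      rw [hT, functional_smul, functional_smul, functional_shift_gamma hG hcomm u hφi]
    have hT0 : ∀ v, 0 ≤ T v := fun v => mul_nonneg (inv_nonneg.mpr (hpos u).le) (by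
      simpa using shift_mono hG.structure_nonneg u (f := 0) hφ.2.1 v)
    have hTr : T G.root = 1 := by
      simp [hT, shift_root hG, (hpos u).ne']
    set p : ℝ := (B.repr (G.gamma B ^ n) u : ℂ).re * φ u with hp
    have hp0 : 0 < p := mul_pos hc (hpos u)
    have hle : ∀ v, p * T v ≤ φ v := fun v => by
      have := coeff_mul_shift_le hG hn u hφ.2.1 hφi v
      have h2 := (hpos u).ne'
      simp only [hT, hp, Pi.smul_apply, smul_eq_mul]
      rwa [mul_assoc, mul_inv_cancel_left₀ h2]
    have hp1 : p ≤ 1 := by simpa [hTr, hφ.1] using hle G.root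
    -- Half of the admissible weight is used, so that the complementary weight is nonzero.
    set g : W → ℝ := (1 - p / 2)⁻¹ • (φ - (p / 2) • T) with hg
    have hq : 0 < 1 - p / 2 := by linarith
    have hgmem : g ∈ G.harmonic := by
      refine ⟨?_, fun v => ?_, (harmonic_iff_functional hG g).mpr fun x => ?_⟩
      · simp [hg, hTr, hφ.1, hq.ne']
      · refine mul_nonneg (inv_nonneg.mpr hq.le) ?_
        have h1 := hle v
        have h2 := mul_nonneg hp0.le (hT0 v)
        simp only [Pi.sub_apply, Pi.smul_apply, smul_eq_mul]
        linarith
      · rw [hg, functional_smul, functional_smul, functional_sub, functional_sub,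
          functional_smul B _ T, functional_smul B _ T, hφi, hTi]
    have hTmem : T ∈ G.harmonic := ⟨hTr, hT0, (harmonic_iff_functional hG T).mpr hTi⟩
    have hTφ : T = φ := by
      refine (mem_extremePoints_iff_left.mp hext).2 T hTmem g hgmem
        ⟨p / 2, 1 - p / 2, by positivity, hq, by ring, ?_⟩
      rw [hg, smul_inv_smul₀ hq.ne', add_sub_cancel]
    intro v
    have := congrFun hTφ v
    simp only [hT, Pi.smul_apply, smul_eq_mul] at this
    rw [← this, mul_inv_cancel_left₀ (hpos u).ne']
  · intro hmul
    have key : ∀ ψ ∈ G.harmonic, ∀ a : ℝ, 0 < a → (∀ v, a * ψ v ≤ φ v) → ∀ v, ψ v ≤ φ v := by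
      intro ψ hψ a ha hle u
      obtain ⟨n, hn, hu⟩ := hocc u
      have := shift_le_of_multiplicative hG hcomm hn hu hpos hφi (hmul u) hψ.2.1
        ((harmonic_iff_functional hG ψ).mp hψ.2.2) (C := a⁻¹)
        (fun v => (le_inv_mul_iff₀ ha).mpr (hle v)) G.root
      rwa [shift_root hG, hψ.1, mul_one] at this
    refine mem_extremePoints_iff_left.mpr ⟨hφ, ?_⟩
    rintro ψ₁ h₁ ψ₂ h₂ ⟨a, b, ha, hb, hab, heq⟩
    have hval : ∀ v, a * ψ₁ v + b * ψ₂ v = φ v := fun v => congrFun heq v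
    have k₁ := key ψ₁ h₁ a ha fun v => by
      have := mul_nonneg hb.le (h₂.2.1 v)
      linarith [hval v]
    have k₂ := key ψ₂ h₂ b hb fun v => by
      have := mul_nonneg ha.le (h₁.2.1 v)
      linarith [hval v]
    funext v
    refine le_antisymm (k₁ v) ?_
    have h3 := hval v
    have h4 := mul_le_mul_of_nonneg_left (k₂ v) hb.le
    have h5 : φ v = a * φ v + b * φ v := by rw [← add_mul, hab, one_mul]
    exact le_of_mul_le_mul_left (by linarith) ha

end GradedGraph

end

noncomputable section

/-! ### Bases with nonnegative structure constants -/

section NonnegReal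

variable {k : Subfield ℂ}

theorem IsNonnegReal.zero : IsNonnegReal (0 : k) := by simp [IsNonnegReal]

theorem IsNonnegReal.one : IsNonnegReal (1 : k) := by simp [IsNonnegReal]

theorem IsNonnegReal.mul {x y : k} (hx : IsNonnegReal x) (hy : IsNonnegReal y) :
    IsNonnegReal (x * y) := by
  refine ⟨?_, ?_⟩
  · simp only [MulMemClass.coe_mul, Complex.mul_re, hx.2, hy.2, mul_zero, sub_zero]
    exact mul_nonneg hx.1 hy.1
  · simp [hx.2, hy.2]

theorem IsNonnegReal.sum {ι : Type*} {s : Finset ι} {x : ι → k}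
    (hx : ∀ i ∈ s, IsNonnegReal (x i)) : IsNonnegReal (∑ i ∈ s, x i) := by
  refine ⟨?_, ?_⟩
  · simp only [AddSubmonoidClass.coe_finsetSum, Complex.re_sum]
    exact Finset.sum_nonneg fun i hi => (hx i hi).1
  · simp only [AddSubmonoidClass.coe_finsetSum, Complex.im_sum]
    exact Finset.sum_eq_zero fun i hi => (hx i hi).2

theorem IsNonnegReal.re_pos {x : k} (hx : IsNonnegReal x) (h : x ≠ 0) : 0 < (x : ℂ).re :=
  lt_of_le_of_ne hx.1 fun h0 => h (Subtype.ext (Complex.ext h0.symm hx.2))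

theorem IsNonnegReal.sum_ne_zero {ι : Type*} {s : Finset ι} {x : ι → k}
    (hx : ∀ i ∈ s, IsNonnegReal (x i)) {i : ι} (hi : i ∈ s) (h : x i ≠ 0) :
    ∑ i ∈ s, x i ≠ 0 := by
  intro h0
  have h1 : (((∑ i ∈ s, x i : k) : ℂ)).re = 0 := by simp [h0]
  simp only [AddSubmonoidClass.coe_finsetSum, Complex.re_sum] at h1
  exact ((hx i hi).re_pos h).ne'
    ((Finset.sum_eq_zero_iff_of_nonneg fun j hj => (hx j hj).1).mp h1 i hi)

end NonnegReal

namespace Module.Basis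

variable {k : Subfield ℂ} {X P : Type*} [Ring P] [Algebra k P] (E : Module.Basis X k P)

theorem repr_mul_apply (p q : P) (w : X) :
    E.repr (p * q) w = ∑ z ∈ (E.repr p).support ×ˢ (E.repr q).support,
      E.repr p z.1 * E.repr q z.2 * E.repr (E z.1 * E z.2) w := by
  have hp := E.linearCombination_repr p
  have hq := E.linearCombination_repr q
  rw [Finsupp.linearCombination_apply, Finsupp.sum] at hp hq
  conv_lhs => rw [← hp, ← hq]
  rw [Finset.sum_mul_sum, ← Finset.sum_product', map_sum, Finsupp.finsetSum_apply]
  refine Finset.sum_congr rfl fun z _ => ?_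
  rw [smul_mul_smul_comm, map_smul, Finsupp.smul_apply, smul_eq_mul]

theorem isNonnegReal_repr_self (x w : X) : IsNonnegReal (E.repr (E x) w) := by
  classical
  rw [E.repr_self_apply]
  split_ifs
  exacts [.one, .zero]

theorem exists_of_repr_mul_ne_zero {p q : P} {w : X} (h : E.repr (p * q) w ≠ 0) :
    ∃ x y, E.repr p x ≠ 0 ∧ E.repr q y ≠ 0 ∧ E.repr (E x * E y) w ≠ 0 := by
  rw [repr_mul_apply] at h
  obtain ⟨⟨x, y⟩, hz, hne⟩ := Finset.exists_ne_zero_of_sum_ne_zero h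
  rw [Finset.mem_product, Finsupp.mem_support_iff, Finsupp.mem_support_iff] at hz
  exact ⟨x, y, hz.1, hz.2, right_ne_zero_of_mul hne⟩

variable {E}

theorem isNonnegReal_repr_mul (hE : ∀ x y w, IsNonnegReal (E.repr (E x * E y) w)) {p q : P}
    (hp : ∀ x, IsNonnegReal (E.repr p x)) (hq : ∀ x, IsNonnegReal (E.repr q x)) (w : X) :
    IsNonnegReal (E.repr (p * q) w) := by
  rw [repr_mul_apply]
  exact .sum fun z _ => ((hp _).mul (hq _)).mul (hE _ _ _)

theorem isNonnegReal_repr_pow (hE : ∀ x y w, IsNonnegReal (E.repr (E x * E y) w)) {r : X}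
    (hr : E r = 1) {p : P} (hp : ∀ x, IsNonnegReal (E.repr p x)) (n : ℕ) (w : X) :
    IsNonnegReal (E.repr (p ^ n) w) := by
  induction n generalizing w with
  | zero => rw [pow_zero, ← hr]; exact E.isNonnegReal_repr_self r w
  | succ n ih => rw [pow_succ]; exact isNonnegReal_repr_mul hE ih hp w

/-- There is no cancellation in products of elements with nonnegative coordinates. -/
theorem repr_mul_ne_zero (hE : ∀ x y w, IsNonnegReal (E.repr (E x * E y) w)) {p q : P}
    (hp : ∀ x, IsNonnegReal (E.repr p x)) (hq : ∀ x, IsNonnegReal (E.repr q x)) {x y w : X}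
    (hx : E.repr p x ≠ 0) (hy : E.repr q y ≠ 0) (hw : E.repr (E x * E y) w ≠ 0) :
    E.repr (p * q) w ≠ 0 := by
  rw [repr_mul_apply]
  exact IsNonnegReal.sum_ne_zero (fun z _ => ((hp _).mul (hq _)).mul (hE _ _ _)) (i := (x, y))
    (by simp [hx, hy]) (mul_ne_zero (mul_ne_zero hx hy) hw)

end Module.Basis

/-! ### The basis of `R[q]` and the expansion -/

/-- The monomials `z^β` form a `k`-basis of the Laurent polynomial ring. -/
def laurentBasis (k : Subfield ℂ) (m : ℕ) : Module.Basis (Fin m → ℤ) k (LaurentRing k m) :=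
  .ofRepr (AddMonoidAlgebra.coeffLinearEquiv k)

theorem IsNonnegLaurent.single_mul {k : Subfield ℂ} {m : ℕ} {p : LaurentRing k m}
    (hp : IsNonnegLaurent p) (β : Fin m → ℤ) :
    IsNonnegLaurent (AddMonoidAlgebra.single β (1 : k) * p) := by
  intro δ
  rw [AddMonoidAlgebra.coeff_single_mul_apply, one_mul]
  exact hp _

variable {k : Subfield ℂ} {m : ℕ} {V : Type*}
  {R : Type*} [Ring R] [Algebra (LaurentRing k m) R] [Algebra k R]
  [IsScalarTower k (LaurentRing k m) R]

/-- The basis `b` makes the `k[Z^{±1}]`-algebra `R` a commutative algebra attached to the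
positively multiplicative graph `Γ` rooted at `v₀`; the adjacency matrix acts as multiplication by
the element `∑ i, a_{i,v₀} b_i`. -/
structure IsPMBasis [Fintype V] (Γ : FinGraph k m V) (v₀ : V)
    (b : Module.Basis V (LaurentRing k m) R) : Prop where
  root : b v₀ = 1
  comm : ∀ x y : R, x * y = y * x
  nonneg : ∀ i j l, IsNonnegLaurent (b.repr (b i * b j) l)
  adj_mul : ∀ j, (∑ i, Γ.adj i v₀ • b i) * b j = ∑ i, Γ.adj i j • b i

namespace IsPMBasis

/-- The `k`-basis of `R[q]` formed by the elements `q^ℓ z^β b_i`, for all triples `(i, β, ℓ)`. -/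
def expBasis (b : Module.Basis V (LaurentRing k m) R) :
    Module.Basis (V × (Fin m → ℤ) × ℕ) k (Polynomial R) :=
  (((laurentBasis k m).smulTower b).smulTower (Polynomial.basisMonomials R)).reindex
    (((Equiv.prodComm _ _).prodCongr (Equiv.refl _)).trans (Equiv.prodAssoc _ _ _))

theorem expBasis_apply (b : Module.Basis V (LaurentRing k m) R) (x : V × (Fin m → ℤ) × ℕ) :
    expBasis b x = Polynomial.monomial x.2.2
      ((AddMonoidAlgebra.single x.2.1 (1 : k) : LaurentRing k m) • b x.1) := by
  rw [expBasis, Module.Basis.reindex_apply, Module.Basis.smulTower_apply,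
    Module.Basis.smulTower_apply, Polynomial.coe_basisMonomials, Polynomial.smul_monomial,
    smul_eq_mul, mul_one]
  rfl

theorem expBasis_repr_monomial (b : Module.Basis V (LaurentRing k m) R) (n : ℕ) (r : R)
    (x : V × (Fin m → ℤ) × ℕ) : (expBasis b).repr (Polynomial.monomial n r) x =
      if n = x.2.2 then (b.repr r x.1).coeff x.2.1 else 0 := by
  rw [expBasis, Module.Basis.repr_reindex_apply, Module.Basis.smulTower_repr,
    Module.Basis.smulTower_repr]
  have h : ((Polynomial.basisMonomials R).repr (Polynomial.monomial n r)) x.2.2 =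
      if n = x.2.2 then r else 0 := Polynomial.coeff_monomial
  change (b.repr ((Polynomial.basisMonomials R).repr (Polynomial.monomial n r) x.2.2) x.1).coeff
    x.2.1 = _
  rw [h]
  split_ifs <;> simp

theorem expBasis_mul (b : Module.Basis V (LaurentRing k m) R) (x y : V × (Fin m → ℤ) × ℕ) :
    expBasis b x * expBasis b y = Polynomial.monomial (x.2.2 + y.2.2)
      ((AddMonoidAlgebra.single (x.2.1 + y.2.1) (1 : k) : LaurentRing k m) • (b x.1 * b y.1)) := by
  rw [expBasis_apply, expBasis_apply, Polynomial.monomial_mul_monomial, smul_mul_smul_comm,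
    AddMonoidAlgebra.single_mul_single, one_mul]

theorem linearIndependent_vertex (Γ : FinGraph k m V) (v₀ : V)
    (b : Module.Basis V (LaurentRing k m) R) :
    LinearIndependent k fun x : Γ.ExpVertex v₀ => expBasis b x.1 :=
  (expBasis b).linearIndependent.comp (fun x : Γ.ExpVertex v₀ => x.1) fun _ _ h => Subtype.ext h

variable [Fintype V] {Γ : FinGraph k m V} {v₀ : V} {b : Module.Basis V (LaurentRing k m) R}

theorem expBasis_root (h : IsPMBasis Γ v₀ b) : expBasis b (v₀, 0, 0) = 1 := by
  rw [expBasis_apply]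
  simp only [h.root]
  rw [← AddMonoidAlgebra.one_def, one_smul, Polynomial.monomial_zero_one]

theorem expBasis_mul_nonneg (h : IsPMBasis Γ v₀ b) (x y w : V × (Fin m → ℤ) × ℕ) :
    IsNonnegReal ((expBasis b).repr (expBasis b x * expBasis b y) w) := by
  rw [expBasis_mul, expBasis_repr_monomial]
  split_ifs
  · rw [map_smul, Finsupp.smul_apply, smul_eq_mul]
    exact (h.nonneg _ _ _).single_mul _ _
  · exact .zero

/-- The element `γ = q ∑ i, a_{i,v₀} b_i` of `R[q]`. -/
def expGamma (Γ : FinGraph k m V) (v₀ : V) (b : Module.Basis V (LaurentRing k m) R) :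
    Polynomial R :=
  Polynomial.monomial 1 (∑ i, Γ.adj i v₀ • b i)

theorem expGamma_mul (h : IsPMBasis Γ v₀ b) (x : V × (Fin m → ℤ) × ℕ) :
    expGamma Γ v₀ b * expBasis b x = Polynomial.monomial (x.2.2 + 1)
      ((AddMonoidAlgebra.single x.2.1 (1 : k) : LaurentRing k m) • ∑ i, Γ.adj i x.1 • b i) := by
  rw [expGamma, expBasis_apply, Polynomial.monomial_mul_monomial, mul_smul_comm, h.adj_mul,
    add_comm 1]

theorem expGamma_mul_repr (h : IsPMBasis Γ v₀ b) (x y : V × (Fin m → ℤ) × ℕ) :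
    (expBasis b).repr (expGamma Γ v₀ b * expBasis b x) y =
      if y.2.2 = x.2.2 + 1 then (Γ.adj y.1 x.1).coeff (y.2.1 - x.2.1) else 0 := by
  rw [h.expGamma_mul, expBasis_repr_monomial]
  simp only [eq_comm (a := y.2.2)]
  split_ifs
  · rw [map_smul, Finsupp.smul_apply, smul_eq_mul, b.repr_sum_self,
      AddMonoidAlgebra.coeff_single_mul_apply, one_mul, neg_add_eq_sub]
  · rfl

theorem expGamma_nonneg (h : IsPMBasis Γ v₀ b) (x : V × (Fin m → ℤ) × ℕ) :
    IsNonnegReal ((expBasis b).repr (expGamma Γ v₀ b) x) := by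
  have := h.expGamma_mul_repr (v₀, 0, 0) x
  rw [h.expBasis_root, mul_one] at this
  rw [this]
  split_ifs
  exacts [Γ.nonneg _ _ _, .zero]

/-- The vertices of the expansion are the triples `x` such that `b_x` occurs in a power
of `γ`. -/
theorem reachable_iff (h : IsPMBasis Γ v₀ b) (x : V × (Fin m → ℤ) × ℕ) :
    Γ.Reachable v₀ x ↔ ∃ n : ℕ, (expBasis b).repr (expGamma Γ v₀ b ^ n) x ≠ 0 := by
  have hE := h.expBasis_mul_nonneg
  have hpow := Module.Basis.isNonnegReal_repr_pow hE h.expBasis_root h.expGamma_nonneg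
  constructor
  · intro hx
    induction hx with
    | root => exact ⟨0, by simp [← h.expBasis_root]⟩
    | step i j β δ l _ hδ ih =>
      obtain ⟨n, hn⟩ := ih
      refine ⟨n + 1, ?_⟩
      have h1 : (expBasis b).repr (expGamma Γ v₀ b * expBasis b (i, β, l))
          (j, β + δ, l + 1) ≠ 0 := by
        rw [h.expGamma_mul_repr]
        simpa using hδ
      obtain ⟨y, z, hy, hz, hyz⟩ := Module.Basis.exists_of_repr_mul_ne_zero _ h1
      obtain rfl : z = (i, β, l) := by
        by_contra hne
        exact hz (by rw [Module.Basis.repr_self, Finsupp.single_eq_of_ne hne])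
      rw [pow_succ']
      exact Module.Basis.repr_mul_ne_zero hE h.expGamma_nonneg (hpow n) hy hn hyz
  · rintro ⟨n, hn⟩
    induction n generalizing x with
    | zero =>
      rw [pow_zero, ← h.expBasis_root] at hn
      have : x = (v₀, 0, 0) := by
        by_contra hne
        exact hn (by rw [Module.Basis.repr_self, Finsupp.single_eq_of_ne hne])
      exact this ▸ .root
    | succ n ih =>
      rw [pow_succ'] at hn
      obtain ⟨y, z, hy, hz, hyz⟩ := Module.Basis.exists_of_repr_mul_ne_zero _ hn
      have h1 : (expBasis b).repr (expGamma Γ v₀ b * expBasis b z) x ≠ 0 :=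
        Module.Basis.repr_mul_ne_zero hE h.expGamma_nonneg
          ((expBasis b).isNonnegReal_repr_self z) hy (y := z) (by simp) hyz
      rw [h.expGamma_mul_repr] at h1
      split_ifs at h1 with h2
      · have := FinGraph.Reachable.step z.1 x.1 z.2.1 (x.2.1 - z.2.1) z.2.2 (ih z hz) h1
        rwa [add_sub_cancel, ← h2] at this
      · exact absurd rfl h1

theorem reachable_of_repr_mul_ne_zero (h : IsPMBasis Γ v₀ b) {x y w : V × (Fin m → ℤ) × ℕ}
    (hx : Γ.Reachable v₀ x) (hy : Γ.Reachable v₀ y)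
    (hw : (expBasis b).repr (expBasis b x * expBasis b y) w ≠ 0) : Γ.Reachable v₀ w := by
  have hE := h.expBasis_mul_nonneg
  have hpow := Module.Basis.isNonnegReal_repr_pow hE h.expBasis_root h.expGamma_nonneg
  obtain ⟨n, hn⟩ := (h.reachable_iff x).mp hx
  obtain ⟨n', hn'⟩ := (h.reachable_iff y).mp hy
  refine (h.reachable_iff w).mpr ⟨n + n', ?_⟩
  rw [pow_add]
  exact Module.Basis.repr_mul_ne_zero hE (hpow n) (hpow n') hn hn' hw

/-- The algebra `𝒜_e`: the span of the elements `q^ℓ z^β b_i` attached to the vertices of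
the expansion. -/
def expAlgebra (h : IsPMBasis Γ v₀ b) : Subalgebra k (Polynomial R) :=
  Submodule.toSubalgebra
    (Submodule.span k (Set.range fun x : Γ.ExpVertex v₀ => expBasis b x.1))
    (h.expBasis_root ▸ Submodule.subset_span ⟨⟨_, .root⟩, rfl⟩)
    (by
      have hbb : ∀ x y : Γ.ExpVertex v₀, expBasis b x.1 * expBasis b y.1 ∈
          Submodule.span k (Set.range fun x : Γ.ExpVertex v₀ => expBasis b x.1) := by
        intro x y
        rw [← (expBasis b).linearCombination_repr (expBasis b x.1 * expBasis b y.1),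
          Finsupp.linearCombination_apply]
        refine Submodule.sum_mem _ fun w hw => Submodule.smul_mem _ _ (Submodule.subset_span ?_)
        exact ⟨⟨w, h.reachable_of_repr_mul_ne_zero x.2 y.2 (Finsupp.mem_support_iff.mp hw)⟩, rfl⟩
      intro p q hp hq
      induction hp, hq using Submodule.span_induction₂ with
      | mem_mem p q hp hq =>
        obtain ⟨x, rfl⟩ := hp
        obtain ⟨y, rfl⟩ := hq
        exact hbb x y
      | zero_left q hq => rw [zero_mul]; exact zero_mem _
      | zero_right p hp => rw [mul_zero]; exact zero_mem _
      | add_left x y z _ _ _ h1 h2 => rw [add_mul]; exact add_mem h1 h2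
      | add_right x y z _ _ _ h1 h2 => rw [mul_add]; exact add_mem h1 h2
      | smul_left r x y _ _ h => rw [smul_mul_assoc]; exact Submodule.smul_mem _ _ h
      | smul_right r x y _ _ h => rw [mul_smul_comm]; exact Submodule.smul_mem _ _ h)

theorem toSubmodule_expAlgebra (h : IsPMBasis Γ v₀ b) : Subalgebra.toSubmodule h.expAlgebra =
    Submodule.span k (Set.range fun x : Γ.ExpVertex v₀ => expBasis b x.1) :=
  Submodule.toSubalgebra_toSubmodule _ _ _

/-- The basis of `𝒜_e` indexed by the vertices of the expansion. -/
def vertexBasis (h : IsPMBasis Γ v₀ b) : Module.Basis (Γ.ExpVertex v₀) k h.expAlgebra :=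
  (Module.Basis.span (linearIndependent_vertex Γ v₀ b)).map
    (LinearEquiv.ofEq _ _ h.toSubmodule_expAlgebra.symm)

theorem vertexBasis_apply (h : IsPMBasis Γ v₀ b) (x : Γ.ExpVertex v₀) :
    (h.vertexBasis x : Polynomial R) = expBasis b x.1 :=
  congrArg Subtype.val (Module.Basis.span_apply (linearIndependent_vertex Γ v₀ b) x)

theorem vertexBasis_repr (h : IsPMBasis Γ v₀ b) (p : h.expAlgebra) (x : Γ.ExpVertex v₀) :
    h.vertexBasis.repr p x = (expBasis b).repr (p : Polynomial R) x.1 := by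
  have : (h.vertexBasis.coord x) =
      ((expBasis b).coord x.1).comp (Subalgebra.toSubmodule h.expAlgebra).subtype := by
    refine h.vertexBasis.ext fun y => ?_
    have h1 : (Subalgebra.toSubmodule h.expAlgebra).subtype (h.vertexBasis y) = expBasis b y.1 :=
      h.vertexBasis_apply y
    classical
    rw [LinearMap.comp_apply, h1]
    simp only [Module.Basis.coord_apply, Module.Basis.repr_self, Finsupp.single_apply]
    exact if_congr ⟨fun h => h ▸ rfl, fun h => Subtype.ext h⟩ rfl rfl
  exact LinearMap.congr_fun this p

theorem coe_vertexBasis_mul (h : IsPMBasis Γ v₀ b) (u v : Γ.ExpVertex v₀) :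
    ((h.vertexBasis u * h.vertexBasis v : h.expAlgebra) : Polynomial R) =
      expBasis b u.1 * expBasis b v.1 := by
  rw [← h.vertexBasis_apply, ← h.vertexBasis_apply]
  rfl

theorem vertexBasis_root (h : IsPMBasis Γ v₀ b) : h.vertexBasis (Γ.expansion v₀).root = 1 :=
  Subtype.ext ((h.vertexBasis_apply _).trans h.expBasis_root)

theorem expGamma_mem (h : IsPMBasis Γ v₀ b) : expGamma Γ v₀ b ∈ h.expAlgebra := by
  rw [← Subalgebra.mem_toSubmodule, h.toSubmodule_expAlgebra,
    ← (expBasis b).linearCombination_repr (expGamma Γ v₀ b), Finsupp.linearCombination_apply]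
  refine Submodule.sum_mem _ fun w hw => Submodule.smul_mem _ _ (Submodule.subset_span ?_)
  exact ⟨⟨w, (h.reachable_iff w).mpr ⟨1, by simpa using hw⟩⟩, rfl⟩

theorem finsum_weight_smul (h : IsPMBasis Γ v₀ b) (v : Γ.ExpVertex v₀) :
    ∑ᶠ v', (Γ.expansion v₀).weight v v' • h.vertexBasis v' =
      ⟨expGamma Γ v₀ b, h.expGamma_mem⟩ * h.vertexBasis v := by
  classical
  rw [finsum_eq_sum_of_support_subset (s := ((Γ.expansion v₀).finite v).toFinset) _ (fun w hw => by
        simp only [Set.Finite.coe_toFinset, Function.mem_support] at hw ⊢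
        exact left_ne_zero_of_smul hw)]
  refine h.vertexBasis.ext_elem fun w => ?_
  have h1 : ((⟨expGamma Γ v₀ b, h.expGamma_mem⟩ * h.vertexBasis v : h.expAlgebra) : Polynomial R) =
      expGamma Γ v₀ b * expBasis b v.1 := by
    rw [← h.vertexBasis_apply]; rfl
  rw [h.vertexBasis_repr (⟨expGamma Γ v₀ b, h.expGamma_mem⟩ * h.vertexBasis v), h1,
    h.expGamma_mul_repr, map_sum, Finsupp.finsetSum_apply]
  simp only [map_smul, Module.Basis.repr_self, Finsupp.smul_apply, Finsupp.single_apply,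
    smul_eq_mul, mul_ite, mul_one, mul_zero]
  rw [Finset.sum_ite_eq']
  simp only [Set.Finite.mem_toFinset, Function.mem_support]
  change _ = (Γ.expansion v₀).weight v w
  by_cases h2 : (Γ.expansion v₀).weight v w = 0 <;> simp [h2]

theorem gamma_vertexBasis (h : IsPMBasis Γ v₀ b) :
    (Γ.expansion v₀).gamma h.vertexBasis = ⟨expGamma Γ v₀ b, h.expGamma_mem⟩ := by
  rw [GradedGraph.gamma, h.finsum_weight_smul, h.vertexBasis_root, mul_one]

theorem isPositivelyMultiplicative (h : IsPMBasis Γ v₀ b) :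
    (Γ.expansion v₀).IsPositivelyMultiplicative h.vertexBasis where
  root_eq_one := h.vertexBasis_root
  structure_nonneg u v w := by
    rw [h.vertexBasis_repr, h.coe_vertexBasis_mul]
    exact h.expBasis_mul_nonneg _ _ _
  gamma_mul v := by
    rw [h.finsum_weight_smul v]
    exact congrArg (· * _) h.gamma_vertexBasis

theorem exists_repr_gamma_pow_ne_zero (h : IsPMBasis Γ v₀ b) (u : Γ.ExpVertex v₀) :
    ∃ n : ℕ, (∀ w, IsNonnegReal
        (h.vertexBasis.repr ((Γ.expansion v₀).gamma h.vertexBasis ^ n) w)) ∧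
      h.vertexBasis.repr ((Γ.expansion v₀).gamma h.vertexBasis ^ n) u ≠ 0 := by
  obtain ⟨n, hn⟩ := (h.reachable_iff u.1).mp u.2
  rw [h.gamma_vertexBasis]
  refine ⟨n, fun w => ?_, ?_⟩
  · rw [vertexBasis_repr]
    exact Module.Basis.isNonnegReal_repr_pow h.expBasis_mul_nonneg h.expBasis_root
      h.expGamma_nonneg n w.1
  · rwa [vertexBasis_repr]

theorem expAlgebra_mul_comm (h : IsPMBasis Γ v₀ b) (x y : h.expAlgebra) : x * y = y * x :=
  Subtype.ext <| Polynomial.ext fun n => by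
    rw [MulMemClass.coe_mul, MulMemClass.coe_mul, Polynomial.coeff_mul, Polynomial.coeff_mul,
      ← Finset.Nat.sum_antidiagonal_swap]
    exact Finset.sum_congr rfl fun z _ => h.comm _ _

end IsPMBasis

end

noncomputable section

/-! ### Specialization of Laurent polynomials at a positive point -/

section Specialize

variable {k : Subfield ℂ} {m : ℕ} {t : Fin m → ℝ}

theorem monomialValue_pos (ht : ∀ r, 0 < t r) (β : Fin m → ℤ) : 0 < monomialValue t β :=
  Finset.prod_pos fun r _ => zpow_pos (ht r) _

theorem monomialValue_zero (t : Fin m → ℝ) : monomialValue t 0 = 1 := by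
  simp [monomialValue]

theorem monomialValue_add (ht : ∀ r, 0 < t r) (β δ : Fin m → ℤ) :
    monomialValue t (β + δ) = monomialValue t β * monomialValue t δ := by
  rw [monomialValue, monomialValue, monomialValue, ← Finset.prod_mul_distrib]
  exact Finset.prod_congr rfl fun r _ => zpow_add₀ (ht r).ne' _ _

/-- Evaluation of Laurent polynomials at a point with positive real coordinates. -/
def evalAt (k : Subfield ℂ) (ht : ∀ r, 0 < t r) : LaurentRing k m →ₐ[k] ℂ :=
  AddMonoidAlgebra.lift k ℂ (Fin m → ℤ)
    { toFun := fun β => (monomialValue t β.toAdd : ℂ)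
      map_one' := by simp [monomialValue_zero]
      map_mul' := fun β δ => by simp [monomialValue_add ht] }

theorem evalAt_single (ht : ∀ r, 0 < t r) (β : Fin m → ℤ) :
    evalAt k ht (AddMonoidAlgebra.single β 1) = monomialValue t β := by
  rw [evalAt, AddMonoidAlgebra.lift_single, one_smul]
  rfl

theorem evalAt_of_nonneg (ht : ∀ r, 0 < t r) {p : LaurentRing k m} (hp : IsNonnegLaurent p) :
    evalAt k ht p = specialize t p := by
  rw [evalAt, AddMonoidAlgebra.lift_apply, specialize, Finsupp.sum, Finsupp.sum,
    Complex.ofReal_sum]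
  refine Finset.sum_congr rfl fun β _ => ?_
  rw [Complex.ofReal_mul, Subfield.smul_def, smul_eq_mul]
  congr 1
  exact Complex.ext rfl (hp β).2

theorem specialize_nonneg (ht : ∀ r, 0 < t r) {p : LaurentRing k m} (hp : IsNonnegLaurent p) :
    0 ≤ specialize t p :=
  Finset.sum_nonneg fun β _ => mul_nonneg (hp β).1 (monomialValue_pos ht β).le

theorem specialize_pos (ht : ∀ r, 0 < t r) {p : LaurentRing k m} (hp : IsNonnegLaurent p)
    (h : p ≠ 0) : 0 < specialize t p := by
  refine Finset.sum_pos (fun β hβ => mul_pos ?_ (monomialValue_pos ht β)) ?_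
  · exact (hp β).re_pos (Finsupp.mem_support_iff.mp hβ)
  · rw [Finsupp.support_nonempty_iff]
    exact fun h0 => h (AddMonoidAlgebra.coeff_injective h0)

end Specialize

namespace FinGraph

variable {k : Subfield ℂ} {m : ℕ} {V : Type*} {Γ : FinGraph k m V} {t : Fin m → ℝ}

theorem adjAt_nonneg (Γ : FinGraph k m V) (ht : ∀ r, 0 < t r) (i j : V) : 0 ≤ Γ.adjAt t i j :=
  specialize_nonneg ht (Γ.nonneg i j)

theorem StronglyConnected.adjAt_irreducible (hΓ : Γ.StronglyConnected) (ht : ∀ r, 0 < t r)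
    (i j : V) : Relation.TransGen (fun a b => 0 < Γ.adjAt t a b) i j := by
  have h := Relation.transGen_swap.mpr (hΓ j i)
  exact Relation.TransGen.mono (fun a b hab => specialize_pos ht (Γ.nonneg a b) hab) _ _ h

theorem exists_reachable_shift {v₀ i j : V}
    (h : Relation.TransGen (fun a b => Γ.adj b a ≠ 0) i j) :
    ∃ (δ : Fin m → ℤ) (r : ℕ), ∀ β l, Γ.Reachable v₀ (i, β, l) →
      Γ.Reachable v₀ (j, β + δ, l + r) := by
  have hne : ∀ {a b : V}, Γ.adj b a ≠ 0 → ∃ δ, (Γ.adj b a).coeff δ ≠ 0 := by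
    intro a b hab
    by_contra! h0
    exact hab (AddMonoidAlgebra.coeff_injective (Finsupp.ext h0))
  induction h with
  | single h =>
    obtain ⟨δ, hδ⟩ := hne h
    exact ⟨δ, 1, fun β l hr => .step _ _ _ _ _ hr hδ⟩
  | tail _ h ih =>
    obtain ⟨δ, r, hr⟩ := ih
    obtain ⟨δ', hδ'⟩ := hne h
    refine ⟨δ + δ', r + 1, fun β l hb => ?_⟩
    rw [← add_assoc, ← add_assoc]
    exact .step _ _ _ _ _ (hr β l hb) hδ'

theorem StronglyConnected.exists_reachable (hΓ : Γ.StronglyConnected) (v₀ i : V) :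
    ∃ (β : Fin m → ℤ) (l : ℕ), Γ.Reachable v₀ (i, β, l) := by
  obtain ⟨δ, r, h⟩ := exists_reachable_shift (v₀ := v₀) (hΓ v₀ i)
  exact ⟨_, _, h 0 0 .root⟩

variable [Fintype V] [DecidableEq V]

/-- A normalized positive left eigenvector is a left Perron–Frobenius vector. -/
theorem isLeftPerronFrobenius_of_eigenvector (Γ : FinGraph k m V) {v₀ : V} (ht : ∀ r, 0 < t r)
    {π : V → ℝ} {ρ : ℝ} (h0 : π v₀ = 1) (hπ : ∀ i, 0 < π i)
    (h : Matrix.vecMul π (Γ.adjAt t) = ρ • π) : IsLeftPerronFrobenius (Γ.adjAt t) v₀ π :=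
  ⟨h0, hπ, ρ, h, fun _ hμ => PerronFrobenius.norm_le_of_mem_spectrum (Γ.adjAt_nonneg ht) hπ h hμ⟩

theorem StronglyConnected.existsUnique_isLeftPerronFrobenius (hΓ : Γ.StronglyConnected) (v₀ : V)
    (ht : ∀ r, 0 < t r) : ∃ π, IsLeftPerronFrobenius (Γ.adjAt t) v₀ π ∧
      ∀ π', IsLeftPerronFrobenius (Γ.adjAt t) v₀ π' → π' = π := by
  have : Nonempty V := ⟨v₀⟩
  obtain ⟨x, ρ, hx, hxM⟩ := PerronFrobenius.exists_pos_eigenvector (Γ.adjAt_nonneg ht)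
    (hΓ.adjAt_irreducible ht)
  have hM : Matrix.vecMul ((x v₀)⁻¹ • x) (Γ.adjAt t) = ρ • (x v₀)⁻¹ • x := by
    rw [Matrix.smul_vecMul, hxM, smul_comm]
  have hpos : ∀ i, 0 < ((x v₀)⁻¹ • x) i := fun i => mul_pos (inv_pos.mpr (hx v₀)) (hx i)
  have h0 : ((x v₀)⁻¹ • x) v₀ = 1 := inv_mul_cancel₀ (hx v₀).ne'
  refine ⟨(x v₀)⁻¹ • x, Γ.isLeftPerronFrobenius_of_eigenvector ht h0 hpos hM, ?_⟩
  rintro π' ⟨h0', hpos', ρ', hM', -⟩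
  obtain ⟨c, rfl⟩ := PerronFrobenius.eq_smul_of_pos (Γ.adjAt_nonneg ht) (hΓ.adjAt_irreducible ht)
    hpos hM hpos' hM'
  have hc : c = 1 := by
    rw [Pi.smul_apply, h0, smul_eq_mul, mul_one] at h0'
    exact h0'
  rw [hc, one_smul]

end FinGraph

/-! ### Multiplicative functions on the expansion -/

namespace IsPMBasis

variable {k : Subfield ℂ} {m : ℕ} {V : Type*} [Fintype V]
  {R : Type*} [Ring R] [Algebra (LaurentRing k m) R] [Algebra k R]
  [IsScalarTower k (LaurentRing k m) R] {t : Fin m → ℝ}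

/-- The linear functional on `R` that evaluates the coefficients at `t` and sends `b_i`
to `π_i`. -/
def evalBasis (b : Module.Basis V (LaurentRing k m) R) (ht : ∀ r, 0 < t r) (π : V → ℝ) :
    R →ₗ[k] ℂ where
  toFun x := ∑ l, evalAt k ht (b.repr x l) * π l
  map_add' x y := by simp [add_mul, Finset.sum_add_distrib]
  map_smul' c x := by
    rw [← smul_one_smul (LaurentRing k m) c x]
    simp only [map_smul, Finsupp.smul_apply, smul_eq_mul, RingHom.id_apply,
      Finset.smul_sum, smul_mul_assoc, one_mul]

section EvalBasis

variable (b : Module.Basis V (LaurentRing k m) R) (ht : ∀ r, 0 < t r) (π : V → ℝ)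

theorem evalBasis_apply (x : R) :
    evalBasis b ht π x = ∑ l, evalAt k ht (b.repr x l) * π l := rfl

theorem evalBasis_smul (p : LaurentRing k m) (x : R) :
    evalBasis b ht π (p • x) = evalAt k ht p * evalBasis b ht π x := by
  simp [evalBasis_apply, Finset.mul_sum, mul_assoc]

theorem evalBasis_basis (i : V) : evalBasis b ht π (b i) = π i := by
  classical
  rw [evalBasis_apply, Finset.sum_eq_single i]
  · simp
  · intro j _ hj
    rw [Module.Basis.repr_self, Finsupp.single_eq_of_ne hj, map_zero, zero_mul]
  · simp

/-- The linear functional on `R[q]` with value `t^β s^ℓ π_i` on `q^ℓ z^β b_i`. -/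
def evalExp (s : ℝ) : Polynomial R →ₗ[k] ℂ :=
  Polynomial.lsum fun n => ((s : ℂ) ^ n) • evalBasis b ht π

theorem evalExp_monomial (s : ℝ) (n : ℕ) (x : R) :
    evalExp b ht π s (Polynomial.monomial n x) = (s : ℂ) ^ n * evalBasis b ht π x := by
  rw [evalExp, Polynomial.lsum_apply, Polynomial.sum_monomial_index x _ (by simp)]
  rfl

theorem evalExp_expBasis (s : ℝ) (x : V × (Fin m → ℤ) × ℕ) :
    evalExp b ht π s (expBasis b x) =
      ((monomialValue t x.2.1 * s ^ x.2.2 * π x.1 : ℝ) : ℂ) := by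
  rw [expBasis_apply, evalExp_monomial, evalBasis_smul, evalAt_single, evalBasis_basis]
  push_cast
  ring

theorem evalBasis_adj (Γ : FinGraph k m V) (j : V) :
    evalBasis b ht π (∑ i, Γ.adj i j • b i) = Matrix.vecMul π (Γ.adjAt t) j := by
  rw [map_sum, Matrix.vecMul, dotProduct, Complex.ofReal_sum]
  refine Finset.sum_congr rfl fun i _ => ?_
  rw [evalBasis_smul, evalAt_of_nonneg ht (Γ.nonneg i j), evalBasis_basis, Complex.ofReal_mul,
    mul_comm]
  rfl

end EvalBasis

variable {Γ : FinGraph k m V} {v₀ : V} {b : Module.Basis V (LaurentRing k m) R}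

theorem functional_eq_evalExp (h : IsPMBasis Γ v₀ b) (ht : ∀ r, 0 < t r) {π : V → ℝ} {s : ℝ}
    {f : Γ.ExpVertex v₀ → ℝ}
    (hf : ∀ x, f x = monomialValue t x.1.2.1 * s ^ x.1.2.2 * π x.1.1) (p : h.expAlgebra) :
    GradedGraph.functional h.vertexBasis f p = evalExp b ht π s (p : Polynomial R) := by
  have : GradedGraph.functional h.vertexBasis f =
      (evalExp b ht π s).comp (Subalgebra.toSubmodule h.expAlgebra).subtype := by
    refine h.vertexBasis.ext fun x => ?_
    have h1 : (Subalgebra.toSubmodule h.expAlgebra).subtype (h.vertexBasis x) = expBasis b x.1 :=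
      h.vertexBasis_apply x
    rw [LinearMap.comp_apply, h1, evalExp_expBasis, GradedGraph.functional_basis, hf]
  exact LinearMap.congr_fun this p

theorem evalExp_expGamma_mul (h : IsPMBasis Γ v₀ b) (ht : ∀ r, 0 < t r) (π : V → ℝ) (s : ℝ)
    (x : V × (Fin m → ℤ) × ℕ) : evalExp b ht π s (expGamma Γ v₀ b * expBasis b x) =
      ((monomialValue t x.2.1 * s ^ x.2.2 * (s * Matrix.vecMul π (Γ.adjAt t) x.1) : ℝ) : ℂ) := by
  rw [h.expGamma_mul, evalExp_monomial, evalBasis_smul, evalAt_single, evalBasis_adj]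
  push_cast
  ring

/-- The functional attached to a normalized left Perron–Frobenius vector `π` is multiplicative:
for fixed `i`, the vector of the values at `b_i b_j` is a left eigenvector, as multiplication
by `b_i` commutes with the adjacency operator; hence it is a multiple of `π`. -/
theorem evalBasis_mul [DecidableEq V] (h : IsPMBasis Γ v₀ b) (hΓ : Γ.StronglyConnected)
    (ht : ∀ r, 0 < t r) {π : V → ℝ} {ρ : ℝ} (h0 : π v₀ = 1) (hπ : ∀ i, 0 < π i)
    (hM : Matrix.vecMul π (Γ.adjAt t) = ρ • π) (i j : V) :
    evalBasis b ht π (b i * b j) = ((π i * π j : ℝ) : ℂ) := by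
  have : Nonempty V := ⟨v₀⟩
  set y : V → ℝ := fun j => ∑ l, specialize t (b.repr (b i * b j) l) * π l with hy
  have hval : ∀ j, evalBasis b ht π (b i * b j) = y j := by
    intro j
    rw [evalBasis_apply, hy, Complex.ofReal_sum]
    refine Finset.sum_congr rfl fun l _ => ?_
    rw [evalAt_of_nonneg ht (h.nonneg i j l), Complex.ofReal_mul]
  have hA : ∀ x : R, evalBasis b ht π ((∑ i, Γ.adj i v₀ • b i) * x) =
      ρ * evalBasis b ht π x := by
    intro x
    conv_lhs => rw [← b.sum_repr x, Finset.mul_sum, map_sum]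
    rw [evalBasis_apply, Finset.mul_sum]
    refine Finset.sum_congr rfl fun l _ => ?_
    rw [mul_smul_comm, h.adj_mul, evalBasis_smul, evalBasis_adj, hM, Pi.smul_apply, smul_eq_mul,
      Complex.ofReal_mul]
    ring
  have hyM : Matrix.vecMul y (Γ.adjAt t) = ρ • y := by
    funext j
    have h1 := hA (b i * b j)
    rw [← mul_assoc, h.comm _ (b i), mul_assoc, h.adj_mul, Finset.mul_sum, map_sum, hval] at h1
    have h2 : ((Matrix.vecMul y (Γ.adjAt t) j : ℝ) : ℂ) = ((ρ * y j : ℝ) : ℂ) := by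
      rw [Complex.ofReal_mul, ← h1, Matrix.vecMul, dotProduct, Complex.ofReal_sum]
      refine Finset.sum_congr rfl fun l _ => ?_
      rw [mul_smul_comm, evalBasis_smul, evalAt_of_nonneg ht (Γ.nonneg l j), hval,
        Complex.ofReal_mul, mul_comm]
      rfl
    exact_mod_cast h2
  obtain ⟨c, hc⟩ := PerronFrobenius.eq_smul_of_vecMul_eq (Γ.adjAt_nonneg ht)
    (hΓ.adjAt_irreducible ht) hπ hM hyM
  have hci : c = π i := by
    have h1 := hval v₀
    rw [h.root, mul_one, evalBasis_basis, hc, Pi.smul_apply, h0, smul_eq_mul, mul_one] at h1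
    exact_mod_cast h1.symm
  rw [hval, hc, hci]
  rfl

/-- The functions `f_t` are extremal. -/
theorem harmonicAt_mem [DecidableEq V] (h : IsPMBasis Γ v₀ b) (hΓ : Γ.StronglyConnected)
    (ht : ∀ r, 0 < t r) {π : V → ℝ} (hπ : IsLeftPerronFrobenius (Γ.adjAt t) v₀ π) :
    Γ.harmonicAt v₀ t π ∈ (Γ.expansion v₀).extremalPositiveHarmonic := by
  obtain ⟨h0, hpos, ρ, hM, -⟩ := hπ
  have hsum : ∑ i, Γ.adjAt t i v₀ * π i = ρ := by
    have := congrFun hM v₀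
    rw [Pi.smul_apply, h0, smul_eq_mul, mul_one] at this
    rw [← this, Matrix.vecMul, dotProduct]
    exact Finset.sum_congr rfl fun i _ => mul_comm _ _
  have hρ : 0 < ρ := by
    obtain ⟨i, -, hi⟩ := Relation.TransGen.tail'_iff.mp (hΓ.adjAt_irreducible ht v₀ v₀)
    rw [← hsum]
    exact Finset.sum_pos' (fun j _ => mul_nonneg (Γ.adjAt_nonneg ht j v₀) (hpos j).le)
      ⟨i, Finset.mem_univ _, mul_pos hi (hpos i)⟩
  have hval : ∀ x, Γ.harmonicAt v₀ t π x =
      monomialValue t x.1.2.1 * ρ⁻¹ ^ x.1.2.2 * π x.1.1 := fun x => by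
    rw [FinGraph.harmonicAt, hsum]
  have hfpos : ∀ x, 0 < Γ.harmonicAt v₀ t π x := fun x => by
    rw [hval]
    exact mul_pos (mul_pos (monomialValue_pos ht _) (pow_pos (inv_pos.mpr hρ) _)) (hpos _)
  have hharm : Γ.harmonicAt v₀ t π ∈ (Γ.expansion v₀).harmonic := by
    refine ⟨?_, fun x => (hfpos x).le, ?_⟩
    · rw [hval]
      change monomialValue t 0 * ρ⁻¹ ^ 0 * π v₀ = 1
      rw [monomialValue_zero, h0, pow_zero, one_mul, one_mul]
    · refine (GradedGraph.harmonic_iff_functional h.isPositivelyMultiplicative _).mpr fun x => ?_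
      have : (GradedGraph.functional h.vertexBasis (Γ.harmonicAt v₀ t π)).comp
          (LinearMap.mulLeft k ((Γ.expansion v₀).gamma h.vertexBasis)) =
          GradedGraph.functional h.vertexBasis (Γ.harmonicAt v₀ t π) := by
        refine h.vertexBasis.ext fun v => ?_
        rw [LinearMap.comp_apply, LinearMap.mulLeft_apply, GradedGraph.functional_basis,
          h.functional_eq_evalExp ht hval, h.gamma_vertexBasis, MulMemClass.coe_mul,
          h.vertexBasis_apply, h.evalExp_expGamma_mul, hM, Pi.smul_apply, smul_eq_mul,
          inv_mul_cancel_left₀ hρ.ne', hval]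
      exact LinearMap.congr_fun this x
  refine ⟨(GradedGraph.mem_extremePoints_iff_multiplicative h.isPositivelyMultiplicative
    h.expAlgebra_mul_comm h.exists_repr_gamma_pow_ne_zero hharm hfpos).mpr fun u v => ?_, hfpos⟩
  have h1 := GradedGraph.ofReal_shift h.isPositivelyMultiplicative.structure_nonneg u
    (Γ.harmonicAt v₀ t π) v
  rw [h.functional_eq_evalExp ht hval, h.coe_vertexBasis_mul, expBasis_mul, evalExp_monomial,
    evalBasis_smul, evalAt_single, h.evalBasis_mul hΓ ht h0 hpos hM, monomialValue_add ht,
    pow_add] at h1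
  have h2 : ((GradedGraph.shift h.vertexBasis u (Γ.harmonicAt v₀ t π) v : ℝ) : ℂ) =
      ((Γ.harmonicAt v₀ t π u * Γ.harmonicAt v₀ t π v : ℝ) : ℂ) := by
    rw [h1, hval, hval]
    push_cast
    ring
  exact_mod_cast h2

end IsPMBasis

end

noncomputable section

/-! ### From multiplicative functions to Perron–Frobenius vectors -/

/-- A reachable triple as a vertex of the expansion. -/
def FinGraph.Reachable.vertex {k : Subfield ℂ} {m : ℕ} {V : Type*} {Γ : FinGraph k m V} {v₀ : V}
    {x : V × (Fin m → ℤ) × ℕ} (h : Γ.Reachable v₀ x) : Γ.ExpVertex v₀ :=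
  ⟨x, h⟩

namespace IsPMBasis

variable {k : Subfield ℂ} {m : ℕ} {V : Type*} [Fintype V]
  {R : Type*} [Ring R] [Algebra (LaurentRing k m) R] [Algebra k R]
  [IsScalarTower k (LaurentRing k m) R]
  {Γ : FinGraph k m V} {v₀ : V} {b : Module.Basis V (LaurentRing k m) R}

theorem expBasis_root_mul (h : IsPMBasis Γ v₀ b) (i : V) (β β' : Fin m → ℤ) (l l' : ℕ) :
    expBasis b (v₀, β, l) * expBasis b (i, β', l') = expBasis b (i, β + β', l + l') := by
  rw [expBasis_mul, expBasis_apply]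
  simp only [h.root, one_mul]

theorem reachable_add (h : IsPMBasis Γ v₀ b) {i : V} {β β' : Fin m → ℤ} {l l' : ℕ}
    (h1 : Γ.Reachable v₀ (v₀, β, l)) (h2 : Γ.Reachable v₀ (i, β', l')) :
    Γ.Reachable v₀ (i, β + β', l + l') :=
  h.reachable_of_repr_mul_ne_zero h1 h2 (by rw [h.expBasis_root_mul]; simp)

theorem mul_apply_of_multiplicative (h : IsPMBasis Γ v₀ b) {f : Γ.ExpVertex v₀ → ℝ}
    (hmul : ∀ u v, GradedGraph.shift h.vertexBasis u f v = f u * f v)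
    {i : V} {β β' : Fin m → ℤ} {l l' : ℕ}
    (h1 : Γ.Reachable v₀ (v₀, β, l)) (h2 : Γ.Reachable v₀ (i, β', l')) :
    f (h.reachable_add h1 h2).vertex = f h1.vertex * f h2.vertex := by
  have h3 := GradedGraph.ofReal_shift h.isPositivelyMultiplicative.structure_nonneg
    h1.vertex f h2.vertex
  have h4 : h.vertexBasis h1.vertex * h.vertexBasis h2.vertex =
      h.vertexBasis (h.reachable_add h1 h2).vertex :=
    Subtype.ext <| by
      rw [h.coe_vertexBasis_mul, h.vertexBasis_apply]
      exact h.expBasis_root_mul _ _ _ _ _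
  rw [h4, GradedGraph.functional_basis, hmul] at h3
  exact_mod_cast h3.symm

/-- On the vertices lying over the root, a positive multiplicative function is a character of a
submonoid of `ℤ^m × ℕ`, hence the restriction of a character `(β, ℓ) ↦ t^β s^ℓ`. -/
theorem exists_character (h : IsPMBasis Γ v₀ b) {f : Γ.ExpVertex v₀ → ℝ} (hpos : ∀ v, 0 < f v)
    (hmul : ∀ u v, GradedGraph.shift h.vertexBasis u f v = f u * f v) :
    ∃ (t : Fin m → ℝ) (s : ℝ), (∀ r, 0 < t r) ∧ 0 < s ∧
      ∀ β l (hr : Γ.Reachable v₀ (v₀, β, l)), f hr.vertex = monomialValue t β * s ^ l := by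
  let S : AddSubmonoid ((Fin m → ℤ) × ℕ) :=
    { carrier := {x | Γ.Reachable v₀ (v₀, x.1, x.2)}
      zero_mem' := .root
      add_mem' := fun hx hy => h.reachable_add hx hy }
  let g : S →+ ℝ := AddMonoidHom.mk' (fun x => Real.log (f (FinGraph.Reachable.vertex x.2)))
    fun x y => by
      rw [← Real.log_mul (hpos _).ne' (hpos _).ne']
      exact congrArg Real.log (h.mul_apply_of_multiplicative hmul x.2 y.2)
  let ι : S →+ (Fin m → ℤ) × ℤ :=
    ((AddMonoidHom.id (Fin m → ℤ)).prodMap (Nat.castAddMonoidHom ℤ)).comp S.subtype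
  have hι : Function.Injective ι := by
    rintro ⟨⟨β, l⟩, hx⟩ ⟨⟨β', l'⟩, hy⟩ hxy
    have h1 : (β, (l : ℤ)) = (β', (l' : ℤ)) := hxy
    simp only [Prod.mk.injEq, Nat.cast_inj] at h1
    exact Subtype.ext (Prod.ext h1.1 h1.2)
  obtain ⟨L, hL⟩ := AddMonoidHom.exists_extension_real ι hι g
  refine ⟨fun r => Real.exp (L (Pi.single r 1, 0)), Real.exp (L (0, 1)),
    fun r => Real.exp_pos _, Real.exp_pos _, fun β l hr => ?_⟩
  have h1 : L (β, (l : ℤ)) = Real.log (f hr.vertex) := hL ⟨(β, l), hr⟩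
  have h2 : ((β, (l : ℤ)) : (Fin m → ℤ) × ℤ) =
      ∑ r, β r • ((Pi.single r 1, 0) : (Fin m → ℤ) × ℤ) + l • ((0, 1) : (Fin m → ℤ) × ℤ) := by
    refine Prod.ext ?_ ?_
    · rw [Prod.fst_add, Prod.fst_sum]
      funext j
      simp [Finset.sum_apply, Pi.single_apply]
    · rw [Prod.snd_add, Prod.snd_sum]
      simp
  rw [← Real.exp_log (hpos hr.vertex), ← h1, h2, map_add, map_sum, Real.exp_add, Real.exp_sum,
    map_nsmul, nsmul_eq_mul, Real.exp_nat_mul, monomialValue]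
  congr 1
  refine Finset.prod_congr rfl fun r _ => ?_
  rw [map_zsmul, zsmul_eq_mul, mul_comm, Real.exp_mul, Real.rpow_intCast]

/-- A positive multiplicative function is determined by a character of `ℤ^m × ℤ` and one value for
each vertex of `Γ`: two vertices of the expansion over the same vertex `i` are compared by
following a path from `i` to the root. -/
theorem exists_eq_of_multiplicative (h : IsPMBasis Γ v₀ b) (hΓ : Γ.StronglyConnected)
    {f : Γ.ExpVertex v₀ → ℝ} (hpos : ∀ v, 0 < f v)
    (hmul : ∀ u v, GradedGraph.shift h.vertexBasis u f v = f u * f v) :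
    ∃ (t : Fin m → ℝ) (s : ℝ) (π : V → ℝ), (∀ r, 0 < t r) ∧ 0 < s ∧ (∀ i, 0 < π i) ∧
      ∀ x, f x = monomialValue t x.1.2.1 * s ^ x.1.2.2 * π x.1.1 := by
  obtain ⟨t, s, ht, hs, hchar⟩ := h.exists_character hpos hmul
  choose β₀ l₀ hr₀ using hΓ.exists_reachable v₀
  have hχ : ∀ β l, 0 < monomialValue t β * s ^ l := fun β l =>
    mul_pos (monomialValue_pos ht β) (pow_pos hs l)
  refine ⟨t, s, fun i => f (hr₀ i).vertex / (monomialValue t (β₀ i) * s ^ l₀ i), ht, hs,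
    fun i => div_pos (hpos _) (hχ _ _), ?_⟩
  rintro ⟨⟨i, β, l⟩, hx⟩
  -- `(z^(β₀ + δ) q^(l₀ + r)) (z^β q^l b_i) = (z^(β + δ) q^(l + r)) (z^β₀ q^l₀ b_i)`.
  obtain ⟨δ, r, hret⟩ := FinGraph.exists_reachable_shift (v₀ := v₀) (hΓ i v₀)
  have h1 := h.mul_apply_of_multiplicative hmul (hret _ _ (hr₀ i)) hx
  have h2 := h.mul_apply_of_multiplicative hmul (hret _ _ hx) (hr₀ i)
  have h3 : f (h.reachable_add (hret _ _ (hr₀ i)) hx).vertex =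
      f (h.reachable_add (hret _ _ hx) (hr₀ i)).vertex := by
    congr 1
    refine Subtype.ext (Prod.ext rfl (Prod.ext ?_ ?_))
    · change β₀ i + δ + β = β + δ + β₀ i
      abel
    · change l₀ i + r + l = l + r + l₀ i
      omega
  rw [h1, h2, hchar, hchar, monomialValue_add ht, monomialValue_add ht, pow_add, pow_add] at h3
  change f (FinGraph.Reachable.vertex hx) = monomialValue t β * s ^ l *
    (f (hr₀ i).vertex / (monomialValue t (β₀ i) * s ^ l₀ i))
  rw [mul_div_assoc', eq_div_iff (hχ _ _).ne']
  refine mul_left_cancel₀ (hχ δ r).ne' ?_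
  linear_combination h3

/-- Every extremal positive harmonic function is one of the functions `f_t`. -/
theorem exists_eq_harmonicAt [DecidableEq V] (h : IsPMBasis Γ v₀ b) (hΓ : Γ.StronglyConnected)
    {f : Γ.ExpVertex v₀ → ℝ} (hf : f ∈ (Γ.expansion v₀).extremalPositiveHarmonic) :
    ∃ (t : Fin m → ℝ) (π : V → ℝ), (∀ r, 0 < t r) ∧
      IsLeftPerronFrobenius (Γ.adjAt t) v₀ π ∧ f = Γ.harmonicAt v₀ t π := by
  obtain ⟨hext, hpos⟩ := hf
  have hharm := hext.1
  have hmul := (GradedGraph.mem_extremePoints_iff_multiplicative h.isPositivelyMultiplicative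
    h.expAlgebra_mul_comm h.exists_repr_gamma_pow_ne_zero hharm hpos).mp hext
  obtain ⟨t, s, π, ht, hs, hπ, hval⟩ := h.exists_eq_of_multiplicative hΓ hpos hmul
  have h0 : π v₀ = 1 := by
    have h1 := hval (Γ.expansion v₀).root
    rw [hharm.1] at h1
    change 1 = monomialValue t 0 * s ^ 0 * π v₀ at h1
    rw [monomialValue_zero, pow_zero, one_mul, one_mul] at h1
    exact h1.symm
  have hM : Matrix.vecMul π (Γ.adjAt t) = s⁻¹ • π := by
    funext i
    obtain ⟨β, l, hr⟩ := hΓ.exists_reachable v₀ i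
    have h1 := (GradedGraph.harmonic_iff_functional h.isPositivelyMultiplicative f).mp hharm.2.2
      (h.vertexBasis hr.vertex)
    rw [h.functional_eq_evalExp ht hval, h.gamma_vertexBasis, MulMemClass.coe_mul,
      h.vertexBasis_apply, h.evalExp_expGamma_mul, GradedGraph.functional_basis, hval,
      Complex.ofReal_inj] at h1
    have h2 := mul_left_cancel₀
      (mul_pos (monomialValue_pos ht β) (pow_pos hs l)).ne' h1
    rw [Pi.smul_apply, smul_eq_mul, eq_inv_mul_iff_mul_eq₀ hs.ne']
    exact h2
  have hsum : ∑ i, Γ.adjAt t i v₀ * π i = s⁻¹ := by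
    have := congrFun hM v₀
    rw [Pi.smul_apply, h0, smul_eq_mul, mul_one] at this
    rw [← this, Matrix.vecMul, dotProduct]
    exact Finset.sum_congr rfl fun i _ => mul_comm _ _
  refine ⟨t, π, ht, Γ.isLeftPerronFrobenius_of_eigenvector ht h0 hπ hM, ?_⟩
  funext x
  rw [hval, FinGraph.harmonicAt, hsum, inv_inv]

end IsPMBasis

/-! ### The algebra of a positively multiplicative graph -/

namespace PMGraph

variable {k : Subfield ℂ} {m : ℕ} {V : Type*} [Fintype V] [DecidableEq V]
  {Γ : FinGraph k m V} {v₀ : V}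

theorem linearIndependent_bAlg (D : PMGraph Γ v₀) :
    LinearIndependent (LaurentRing k m) D.bAlg := by
  have h1 : LinearIndependent (LaurentField k m) D.b :=
    D.basis.linearIndependent.map' D.alg.val.toLinearMap
      (LinearMap.ker_eq_bot.mpr Subtype.val_injective)
  have h2 : LinearIndependent (LaurentRing k m) D.b := by
    refine h1.restrict_scalars ?_
    simp only [← Algebra.algebraMap_eq_smul_one]
    exact IsFractionRing.injective (LaurentRing k m) (LaurentField k m)
  exact LinearIndependent.of_comp D.algebra.val.toLinearMap h2

theorem span_bAlg (D : PMGraph Γ v₀) :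
    ⊤ ≤ Submodule.span (LaurentRing k m) (Set.range D.bAlg) := by
  rintro ⟨x, hx⟩ -
  have hx' : x ∈ Submodule.span (LaurentRing k m) (Set.range D.b) := hx
  have h1 : Set.range D.b = D.algebra.val.toLinearMap '' Set.range D.bAlg := by
    rw [← Set.range_comp]
    rfl
  rw [h1, Submodule.span_image] at hx'
  obtain ⟨y, hy, hyx⟩ := hx'
  have : y = ⟨x, hx⟩ := Subtype.ext hyx
  exact this ▸ hy

/-- The elements `b_i` as a `k[Z^{±1}]`-basis of `𝒜`. -/
def algebraBasis (D : PMGraph Γ v₀) : Module.Basis V (LaurentRing k m) D.algebra :=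
  Module.Basis.mk D.linearIndependent_bAlg D.span_bAlg

theorem algebraBasis_apply (D : PMGraph Γ v₀) (i : V) : D.algebraBasis i = D.bAlg i :=
  Module.Basis.mk_apply _ _ i

theorem coe_sum_smul_bAlg (D : PMGraph Γ v₀) (p : V → LaurentRing k m) :
    ((∑ i, p i • D.bAlg i : D.algebra) : Matrix V V (LaurentField k m)) =
      ∑ i, algebraMap (LaurentRing k m) (LaurentField k m) (p i) • D.b i := by
  rw [AddSubmonoidClass.coe_finsetSum]
  refine Finset.sum_congr rfl fun i _ => ?_
  rw [algebraMap_smul]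
  rfl

theorem adjK_mul_b (D : PMGraph Γ v₀) (j : V) :
    Γ.adjK * D.b j = ((∑ i, Γ.adj i j • D.bAlg i : D.algebra) : Matrix V V (LaurentField k m)) := by
  rw [coe_sum_smul_bAlg]
  exact D.adj_mul j

theorem bAlg_mul (D : PMGraph Γ v₀) (i j : V) :
    ∃ c : V → LaurentRing k m, (∀ l, IsNonnegLaurent (c l)) ∧
      D.bAlg i * D.bAlg j = ∑ l, c l • D.bAlg l := by
  choose c hc hcr using D.structure_nonneg i j
  refine ⟨c, hc, Subtype.ext ?_⟩
  rw [coe_sum_smul_bAlg]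
  have h := congrArg (Subtype.val : D.alg → _) (D.basis.sum_repr (D.basis i * D.basis j))
  rw [AddSubmonoidClass.coe_finsetSum] at h
  refine Eq.trans h.symm (Finset.sum_congr rfl fun l _ => ?_)
  rw [hcr]
  rfl

theorem isPMBasis (D : PMGraph Γ v₀) (hcomm : ∀ x y : D.algebra, x * y = y * x) :
    IsPMBasis Γ v₀ D.algebraBasis where
  root := by
    rw [algebraBasis_apply]
    exact Subtype.ext D.b_root
  comm := hcomm
  nonneg i j l := by
    obtain ⟨c, hc, h⟩ := D.bAlg_mul i j
    simp only [← algebraBasis_apply] at h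
    rw [h, Module.Basis.repr_sum_self]
    exact hc l
  adj_mul j := by
    simp only [algebraBasis_apply]
    refine Subtype.ext ?_
    rw [← adjK_mul_b, MulMemClass.coe_mul, ← adjK_mul_b, D.b_root, mul_one]
    rfl

end PMGraph

end

theorem mainTheorem10 (k : Subfield ℂ) (m : ℕ) {V : Type*} [Fintype V] [DecidableEq V]
    (Γ : FinGraph k m V) (v₀ : V) (hΓ : Γ.StronglyConnected) (D : PMGraph Γ v₀)
    (hcomm : ∀ x y : D.algebra, x * y = y * x) (hdom : IsDomain D.algebra) :
    -- The expansion is positively multiplicative for the subalgebra of `𝒜[q]` spanned by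
    -- the elements `q^ℓ z^β b_i` with `(v_i, z^β, ℓ)` a vertex of the expansion.
    (∃ (𝒜e : Subalgebra k (Polynomial D.algebra))
        (B : Module.Basis (Γ.ExpVertex v₀) k 𝒜e),
      Subalgebra.toSubmodule 𝒜e =
        Submodule.span k (Set.range fun x : Γ.ExpVertex v₀ => D.expansionElement x.1) ∧
      (∀ x, (B x : Polynomial D.algebra) = D.expansionElement x.1) ∧
      (Γ.expansion v₀).IsPositivelyMultiplicative B) ∧
    -- The extremal positive harmonic functions are exactly the functions `f_t`.
    ∃ π : (Fin m → ℝ) → V → ℝ,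
      (∀ t, (∀ r, 0 < t r) → IsLeftPerronFrobenius (Γ.adjAt t) v₀ (π t) ∧
        ∀ π', IsLeftPerronFrobenius (Γ.adjAt t) v₀ π' → π' = π t) ∧
      (∀ t, (∀ r, 0 < t r) →
        Γ.harmonicAt v₀ t (π t) ∈ (Γ.expansion v₀).extremalPositiveHarmonic) ∧
      (∀ f ∈ (Γ.expansion v₀).extremalPositiveHarmonic,
        ∃ t, (∀ r, 0 < t r) ∧ f = Γ.harmonicAt v₀ t (π t)) ∧
      ∃ T ⊆ {t : Fin m → ℝ | ∀ r, 0 < t r},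
        Set.BijOn (fun t => Γ.harmonicAt v₀ t (π t)) T
          (Γ.expansion v₀).extremalPositiveHarmonic := by
  have h := D.isPMBasis hcomm
  have hE : ∀ x, IsPMBasis.expBasis D.algebraBasis x = D.expansionElement x := fun x => by
    rw [IsPMBasis.expBasis_apply, D.algebraBasis_apply]
    rfl
  refine ⟨⟨h.expAlgebra, h.vertexBasis, ?_, fun x => ?_, h.isPositivelyMultiplicative⟩, ?_⟩
  · rw [h.toSubmodule_expAlgebra]
    simp only [hE]
  · rw [h.vertexBasis_apply, hE]
  have hex : ∀ t : Fin m → ℝ, ∃ π, (∀ r, 0 < t r) → IsLeftPerronFrobenius (Γ.adjAt t) v₀ π ∧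
      ∀ π', IsLeftPerronFrobenius (Γ.adjAt t) v₀ π' → π' = π := by
    intro t
    by_cases ht : ∀ r, 0 < t r
    · obtain ⟨π, hπ⟩ := hΓ.existsUnique_isLeftPerronFrobenius v₀ ht
      exact ⟨π, fun _ => hπ⟩
    · -- Outside the positive orthant the value of `π` does not matter.
      exact ⟨0, fun h => absurd h ht⟩
  choose π hπ using hex
  have hmem : ∀ t, (∀ r, 0 < t r) →
      Γ.harmonicAt v₀ t (π t) ∈ (Γ.expansion v₀).extremalPositiveHarmonic :=
    fun t ht => h.harmonicAt_mem hΓ ht (hπ t ht).1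
  have hsurj : ∀ f ∈ (Γ.expansion v₀).extremalPositiveHarmonic,
      ∃ t, (∀ r, 0 < t r) ∧ f = Γ.harmonicAt v₀ t (π t) := by
    intro f hf
    obtain ⟨t, π', ht, hπ', rfl⟩ := h.exists_eq_harmonicAt hΓ hf
    exact ⟨t, ht, by rw [(hπ t ht).2 π' hπ']⟩
  refine ⟨π, hπ, hmem, hsurj, ?_⟩
  have hS : Set.SurjOn (fun t => Γ.harmonicAt v₀ t (π t)) {t : Fin m → ℝ | ∀ r, 0 < t r}
      (Γ.expansion v₀).extremalPositiveHarmonic := by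
    intro f hf
    obtain ⟨t, ht, rfl⟩ := hsurj f hf
    exact ⟨t, ht, rfl⟩
  exact hS.exists_bijOn_subset
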